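/- Let $N\ge 1$ be an integer and put $p^*=\frac{Np}{N-p}$ if $1\le p<N$, $p^*=\infty$ if $p>N$; for $p=N$, "$q\le p^*$" and "$q<p^*$" just mean that $q$ is finite. Let $\Omega\subseteq\mathbb R^N$ be open with finite measure, $p\in[1,\infty)$, and let $W^{1,p}_0(\Omega)$ be the closure of $C_c^\infty(\Omega)$ with respect to $\|Du\|_{L^p}$. Let $H:\mathbb R^N\to[0,\infty)$ be convex with $H(z)\ge c|z|^p$ for some $c>0$ and all $z$. Let $f:\Omega\times\mathbb R\to\mathbb R$ be a Carathéodory function with $\sup_{|s|\le t}\|f(\cdot,s)\|_{L^\infty(\Omega)}<\infty$ for all $t>0$, and let $F(x,t)=\int_0^t f(x,s)\,ds$. For given $\mu,\theta\ge 0$ and finite $q\ge 1$ consider the growth condition $$\operatorname{sign}(t)\,f(x,t)\le \mu\,(|t|+\theta)^{q-1}\qquad\text{for a.e. }x\in\Omega\text{ and all }t\in\mathbb R.\tag{G}$$ A function $u\in W^{1,p}_0(\Omega)$ is an energy critical point of $J(v)=\int_\Omega H(Dv)-F(x,v)\,dx$ if $J(u)<\infty$, $f(\cdot,u)u\in L^1(\Omega)$,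 and $u$ minimises $$J_u(v)=\int_\Omega H(Dv)-f(x,u)\,v\,dx\in(-\infty,\infty]$$ among all $v\in W^{1,p}_0(\Omega)$ with $f(\cdot,u)v\in L^1(\Omega)$. (1) Assume, if $p\le N$, that (G) holds for some $\mu,\theta\ge0$ and some finite $q$ with $1\le q\le p^*$ (if $p>N$, (G) is not assumed). Then every energy critical point of $J$ belongs to $L^\infty(\Omega)$. (2) There is a positive continuous function $(p,q)\mapsto C(N,p,q)$ on $\{(p,q):p\ge 1,\ 1\le q<p^*\}$, depending only on $N$, such that, whenever $\Omega,p,H,c,f$ are as above, $H(0)=0$, and (G) holds with some $\mu,\theta\ge 0$ and some finite $q$ with $1\le q<p^*$, every energy critical point $u$ of $J$ satisfies $u\in L^q(\Omega)$ and $$\|u\|_{L^\infty(\Omega)}\le\max\left\{\theta,\;C(N,p,q)\left(\Big(\frac{\mu}{c}\Big)^{\frac Np}\int_\Omega|u|^q\,dx\right)^{\frac{p}{pq+(p-q)N}}\right\}.$$ -/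

import Mathlib

open MeasureTheory Filter
open scoped ContDiff Topology

/-- The space `ℝᴺ` with its Euclidean norm. -/
abbrev RN (N : ℕ) : Type := EuclideanSpace ℝ (Fin N)

/-- The integral `∫ g dm ∈ [-∞, ∞]` of a real function, as the integral of the positive part minus
the integral of the negative part. It is meaningful when one of the two is finite. -/
noncomputable def extIntegral {α : Type*} [MeasurableSpace α] (m : Measure α) (g : α → ℝ) : EReal :=
  ((∫⁻ x, ENNReal.ofReal (g x) ∂m : ENNReal) : EReal) -
    ((∫⁻ x, ENNReal.ofReal (-g x) ∂m : ENNReal) : EReal)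

/-- The critical exponent `p*`: it is `N p / (N - p)` if `p < N`, and `∞` otherwise. For `p = N`,
where `p*` may be any finite number, a real `q` satisfies `q ≤ p*` (or `q < p*`) for some choice of
the finite number exactly when `q < ∞`, so that the value `∞` expresses this for real `q`. -/
noncomputable def critExp (N : ℕ) (p : ℝ) : EReal :=
  if p < (N : ℝ) then (((N : ℝ) * p / ((N : ℝ) - p) : ℝ) : EReal) else ⊤

/-- `u ∈ W^{1,p}_0(Ω)` with weak gradient `Du`: the pair `(u, Du)` is in the closure of the pairs
`(φ, ∇φ)`, `φ ∈ C_c^∞(Ω)`, in `L^p(Ω) × L^p(Ω)^N`. The function `u` determines `Du` almost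
everywhere in `Ω`. If `Ω` has finite measure then, by the Poincaré inequality, this is the closure
of `C_c^∞(Ω)` with respect to `‖Du‖_p`. -/
structure MemW0 {N : ℕ} (Ω : Set (RN N)) (p : ℝ) (u : RN N → ℝ) (Du : RN N → RN N) : Prop where
  memLp : MemLp u (ENNReal.ofReal p) (volume.restrict Ω)
  memLp_grad : MemLp Du (ENNReal.ofReal p) (volume.restrict Ω)
  approx : ∃ φ : ℕ → RN N → ℝ,
    (∀ n, ContDiff ℝ ∞ (φ n) ∧ HasCompactSupport (φ n) ∧ tsupport (φ n) ⊆ Ω) ∧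
    Tendsto (fun n => eLpNorm (fun x => φ n x - u x) (ENNReal.ofReal p) (volume.restrict Ω))
      atTop (𝓝 0) ∧
    Tendsto (fun n => eLpNorm (fun x => gradient (φ n) x - Du x) (ENNReal.ofReal p)
      (volume.restrict Ω)) atTop (𝓝 0)

/-- `f : Ω × ℝ → ℝ` is a Carathéodory function: (Lebesgue) measurable in `x`, continuous in `t`. -/
structure IsCaratheodory {N : ℕ} (Ω : Set (RN N)) (f : RN N → ℝ → ℝ) : Prop where
  aemeasurable : ∀ t : ℝ, AEMeasurable (fun x => f x t) (volume.restrict Ω)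
  continuous : ∀ᵐ x ∂(volume.restrict Ω), Continuous (f x)

/-- `sup_{|s| ≤ t} ‖f(·, s)‖_{L^∞(Ω)} < ∞` for all `t > 0`. -/
def LocBounded {N : ℕ} (Ω : Set (RN N)) (f : RN N → ℝ → ℝ) : Prop :=
  ∀ t : ℝ, 0 < t → ∃ M : ℝ, ∀ s : ℝ, |s| ≤ t → ∀ᵐ x ∂(volume.restrict Ω), |f x s| ≤ M

/-- `sign(t) f(x, t) ≤ μ (|t| + θ)^{q - 1}` for almost every `x ∈ Ω` and all `t`. -/
def OneSidedGrowth {N : ℕ} (Ω : Set (RN N)) (f : RN N → ℝ → ℝ) (μ θ q : ℝ) : Prop :=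
  ∀ᵐ x ∂(volume.restrict Ω), ∀ t : ℝ, Real.sign t * f x t ≤ μ * (|t| + θ) ^ (q - 1)

/-- The standing assumptions: `Ω` is open with finite measure, `p ≥ 1`, `H` is convex with
`H(z) ≥ c |z|^p` for some `c > 0` (so `H ≥ 0`), and `f` is Carathéodory and locally bounded. -/
structure Standing {N : ℕ} (Ω : Set (RN N)) (p c : ℝ) (H : RN N → ℝ) (f : RN N → ℝ → ℝ) :
    Prop where
  isOpen : IsOpen Ω
  finite_measure : volume Ω < ⊤
  one_le : 1 ≤ p
  c_pos : 0 < c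
  convex : ConvexOn ℝ Set.univ H
  coercive : ∀ z, c * ‖z‖ ^ p ≤ H z
  caratheodory : IsCaratheodory Ω f
  locBounded : LocBounded Ω f

/-- `J(v) = ∫_Ω H(Dv) - F(x, v) dx`, where `F(x, t) = ∫_0^t f(x, s) ds`. -/
noncomputable def energyJ {N : ℕ} (Ω : Set (RN N)) (H : RN N → ℝ) (f : RN N → ℝ → ℝ)
    (v : RN N → ℝ) (Dv : RN N → RN N) : EReal :=
  extIntegral (volume.restrict Ω) (fun x => H (Dv x) - ∫ s in (0 : ℝ)..(v x), f x s)

/-- The semi-linearised functional `J_u(v) = ∫_Ω H(Dv) - f(x, u) v dx`. -/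
noncomputable def linearizedJ {N : ℕ} (Ω : Set (RN N)) (H : RN N → ℝ) (f : RN N → ℝ → ℝ)
    (u v : RN N → ℝ) (Dv : RN N → RN N) : EReal :=
  extIntegral (volume.restrict Ω) (fun x => H (Dv x) - f x (u x) * v x)

/-- `v ∈ V_u`, that is `v ∈ W^{1,p}_0(Ω)` (with gradient `Dv`) and `f(·, u) v ∈ L^1(Ω)`. -/
def MemV {N : ℕ} (Ω : Set (RN N)) (p : ℝ) (f : RN N → ℝ → ℝ)
    (u v : RN N → ℝ) (Dv : RN N → RN N) : Prop :=
  MemW0 Ω p v Dv ∧ Integrable (fun x => f x (u x) * v x) (volume.restrict Ω)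

/-- `u ∈ W^{1,p}_0(Ω)`, with weak gradient `Du`, is an energy critical point of `J`: `J(u) < ∞` and
`u` minimises `J_u` on `V_u`. -/
structure IsEnergyCritical {N : ℕ} (Ω : Set (RN N)) (p : ℝ) (H : RN N → ℝ) (f : RN N → ℝ → ℝ)
    (u : RN N → ℝ) (Du : RN N → RN N) : Prop where
  energy_lt_top : energyJ Ω H f u Du < ⊤
  mem : MemV Ω p f u u Du
  minimal : ∀ (v : RN N → ℝ) (Dv : RN N → RN N), MemV Ω p f u v Dv →
    linearizedJ Ω H f u u Du ≤ linearizedJ Ω H f u v Dv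

/-- The set of the pairs `(p, q)` with `p ≥ 1` and `1 ≤ q < p*`. -/
def subcritical (N : ℕ) : Set (ℝ × ℝ) :=
  {z | 1 ≤ z.1 ∧ 1 ≤ z.2 ∧ (z.2 : EReal) < critExp N z.1}

/-! For a level k let φ(k) = ∫ (|u| - k)⁺ (`excess`) and A(k) = |{|u| > k}| (`levelMeas`), so that
formally φ' = -A. An inequality φ^γ ≤ K A with γ < 1 makes φ vanish at a finite level, controlled
explicitly by K and the initial value of φ (`eq_zero_of_rpow_le_decrease`); this level bounds |u|.

Such inequalities come from two estimates of the energy E(k) = ∫_{|u|>k} |Du|^p. From above: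
comparing u with its truncation T_k u in J_u gives c E(k) ≤ H(0) A(k) + ∫ f(x,u)(u - T_k u)
(`IsEnergyCritical.levelEnergy_le`), and u - T_k u = sign(u)(|u| - k)⁺, so a one-sided bound on f is
enough. From below: the W^{1,1} Sobolev inequality and Hölder on {|u| > k} give φ^p ≤ C^p
A^{p-1+p/N} E (`exists_excess_le`), while Sobolev with an exponent r > p bounds the L^r norm of (|u|
- k)⁺ (`exists_rpow_excess_le`).

Boundedness: if p > N, E is at most the total energy and p - 1 + p/N > p, which suffices. If p ≤ N,
choose r ≥ q. Then (G) produces ∫ ((|u| - k)⁺)^r, absorbed on the left for large k because L^r tails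
vanish, and k^{r-1} φ(k), which tends to 0. This smallness forces φ to vanish before level 2k, even
when q = p* (`memLp_top_of_critical`).

Estimate: M = ‖u‖_∞ is now known to be finite. If M > θ, the right side of (G) is at most μ
(2M)^{q-1}. Starting the extinction argument at M/2 bounds M/2 by a power of φ(M/2) ≤ (M/2)^{1-q} ∫
|u|^q; collecting the powers of M leaves a positive exponent since q < p*. -/

/-! ### Extinction of a decreasing function. -/

/-- A nonnegative function `φ` whose decrease is controlled from below by `A`, where `A` is bounded
from below by a sublinear power of `φ`, vanishes at an explicit point. -/
theorem eq_zero_of_rpow_le_decrease {φ A : ℝ → ℝ} {k L γ₁ γ₂ K₁ K₂ : ℝ}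
    (hφ : ∀ h, 0 ≤ φ h) (hA : ∀ h, 0 ≤ A h)
    (hstep : ∀ a b, k ≤ a → a ≤ b → φ b + (b - a) * A b ≤ φ a)
    (hγ₁ : 0 ≤ γ₁) (hγ₁' : γ₁ < 1) (hγ₂ : 0 ≤ γ₂) (hγ₂' : γ₂ < 1) (hK₁ : 0 ≤ K₁) (hK₂ : 0 ≤ K₂)
    (hyp : ∀ h, k ≤ h → h ≤ L → 0 < φ h → φ h ^ γ₁ ≤ K₁ * A h ∨ φ h ^ γ₂ ≤ K₂ * A h)
    (hL : k + K₁ * φ k ^ (1 - γ₁) / (2 ^ (1 - γ₁) - 1)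
      + K₂ * φ k ^ (1 - γ₂) / (2 ^ (1 - γ₂) - 1) ≤ L) :
    φ L = 0 := by
  have hd₁ : 0 < (2 : ℝ) ^ (1 - γ₁) - 1 := by
    linarith [Real.one_lt_rpow (one_lt_two) (sub_pos.2 hγ₁')]
  have hd₂ : 0 < (2 : ℝ) ^ (1 - γ₂) - 1 := by
    linarith [Real.one_lt_rpow (one_lt_two) (sub_pos.2 hγ₂')]
  have anti : ∀ a b, k ≤ a → a ≤ b → φ b ≤ φ a := fun a b ha hab => by
    nlinarith [hstep a b ha hab, mul_nonneg (sub_nonneg.2 hab) (hA b)]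
  set L₀ := k + K₁ * φ k ^ (1 - γ₁) / (2 ^ (1 - γ₁) - 1)
      + K₂ * φ k ^ (1 - γ₂) / (2 ^ (1 - γ₂) - 1) with hL₀
  -- κ s is the level at which φ should have dropped to s. The factors 1/(2^(1-γ) - 1) are chosen so
  -- that halving 2s to s raises the level by exactly K₁ s^(1-γ₁) + K₂ s^(1-γ₂).
  set κ : ℝ → ℝ := fun s => L₀ - K₁ * s ^ (1 - γ₁) / (2 ^ (1 - γ₁) - 1)
      - K₂ * s ^ (1 - γ₂) / (2 ^ (1 - γ₂) - 1) with hκ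
  have hκL : ∀ s, 0 ≤ s → κ s ≤ L := fun s hs => by
    have h1 : 0 ≤ K₁ * s ^ (1 - γ₁) / (2 ^ (1 - γ₁) - 1) := by positivity
    have h2 : 0 ≤ K₂ * s ^ (1 - γ₂) / (2 ^ (1 - γ₂) - 1) := by positivity
    simp only [hκ]; linarith
  have key : ∀ s, 0 < s → k ≤ κ (2 * s) → φ (κ (2 * s)) ≤ 2 * s →
      k ≤ κ s ∧ φ (κ s) ≤ s := by
    intro s hs hk hle
    have hdiff : κ s - κ (2 * s) = K₁ * s ^ (1 - γ₁) + K₂ * s ^ (1 - γ₂) := by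
      simp only [hκ]
      rw [Real.mul_rpow zero_le_two hs.le, Real.mul_rpow zero_le_two hs.le]
      field_simp
      ring
    have hp₁ : 0 ≤ K₁ * s ^ (1 - γ₁) := by positivity
    have hp₂ : 0 ≤ K₂ * s ^ (1 - γ₂) := by positivity
    have hk' : k ≤ κ s := by linarith
    refine ⟨hk', ?_⟩
    -- If φ(κ s) > s, either alternative of `hyp` gives (κ s - κ (2s)) A(κ s) ≥ s, because the step
    -- contains both lengths. But φ can lose less than s when it starts at most at 2s and ends above
    -- s.
    by_contra! hlt
    have hst := hstep _ _ hk (by linarith : κ (2 * s) ≤ κ s)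
    have aux : ∀ γ K : ℝ, 0 ≤ γ → φ (κ s) ^ γ ≤ K * A (κ s) →
        s ≤ K * s ^ (1 - γ) * A (κ s) := by
      intro γ K hγ h
      calc s = s ^ γ * s ^ (1 - γ) := by rw [← Real.rpow_add hs]; simp
        _ ≤ φ (κ s) ^ γ * s ^ (1 - γ) := by gcongr
        _ ≤ K * A (κ s) * s ^ (1 - γ) := by gcongr
        _ = _ := by ring
    have hAs := hA (κ s)
    rw [hdiff] at hst
    rcases hyp _ hk' (hκL s hs.le) (hs.trans hlt) with h | h
    · nlinarith [aux _ _ hγ₁ h, mul_nonneg hp₂ hAs]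
    · nlinarith [aux _ _ hγ₂ h, mul_nonneg hp₁ hAs]
  rcases (hφ k).eq_or_lt with h0 | h0
  · have hkL : k ≤ L := by
      have h1 : 0 ≤ K₁ * φ k ^ (1 - γ₁) / (2 ^ (1 - γ₁) - 1) := by have := hφ k; positivity
      have h2 : 0 ≤ K₂ * φ k ^ (1 - γ₂) / (2 ^ (1 - γ₂) - 1) := by have := hφ k; positivity
      linarith
    exact le_antisymm (h0 ▸ anti k L le_rfl hkL) (hφ L)
  have ind : ∀ j : ℕ, k ≤ κ (φ k / 2 ^ j) ∧ φ (κ (φ k / 2 ^ j)) ≤ φ k / 2 ^ j := by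
    intro j
    induction j with
    | zero =>
      have : κ (φ k / 2 ^ 0) = k := by simp only [hκ, hL₀, pow_zero, div_one]; ring
      rw [this]; simp
    | succ j ih =>
      have h2 : 2 * (φ k / 2 ^ (j + 1)) = φ k / 2 ^ j := by field_simp; ring
      exact key _ (by positivity) (h2 ▸ ih.1) (h2 ▸ ih.2)
  have hle : ∀ j : ℕ, φ L ≤ φ k / 2 ^ j := fun j =>
    (anti _ _ (ind j).1 (hκL _ (by positivity))).trans (ind j).2
  have hlim : Tendsto (fun j : ℕ => φ k / 2 ^ j) atTop (𝓝 0) := by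
    simpa [div_eq_mul_inv] using
      (tendsto_pow_atTop_nhds_zero_of_lt_one (r := (2 : ℝ)⁻¹) (by norm_num)
        (by norm_num)).const_mul (φ k)
  exact le_antisymm (ge_of_tendsto' hlim hle) (hφ L)

/-! ### Excess and superlevel sets. -/

section Levels

variable {α : Type*} [MeasurableSpace α] {m : Measure α} {u : α → ℝ}

/-- The integral of `(|u| - k)⁺`. -/
noncomputable def excess (m : Measure α) (u : α → ℝ) (k : ℝ) : ℝ := ∫ x, max (|u x| - k) 0 ∂m

/-- The measure of `{|u| > k}`. -/
noncomputable def levelMeas (m : Measure α) (u : α → ℝ) (k : ℝ) : ℝ := m.real {x | k < |u x|}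

theorem excess_nonneg (k : ℝ) : 0 ≤ excess m u k := integral_nonneg fun _ => le_max_right _ _

theorem levelMeas_nonneg (k : ℝ) : 0 ≤ levelMeas m u k := measureReal_nonneg

theorem nullMeasurableSet_level (hu : AEStronglyMeasurable u m) (k : ℝ) :
    NullMeasurableSet {x | k < |u x|} m :=
  nullMeasurableSet_lt aemeasurable_const hu.norm.aemeasurable

theorem integral_indicator_one_level (hu : AEStronglyMeasurable u m) (k : ℝ) :
    ∫ x, {x | k < |u x|}.indicator (fun _ => (1 : ℝ)) x ∂m = levelMeas m u k := by
  rw [integral_indicator₀ (nullMeasurableSet_level hu k)]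
  simp [levelMeas, measureReal_def]

variable [IsFiniteMeasure m]

theorem integrable_max_sub (hu : Integrable u m) (k : ℝ) :
    Integrable (fun x => max (|u x| - k) 0) m :=
  (hu.abs.sub (integrable_const k)).pos_part

/-- Integrates the pointwise bound (t - b)⁺ + (b - a) 1_{t>b} ≤ (t - a)⁺. It is the
finite-difference substitute for φ' = -A. -/
theorem excess_add_le (hu : Integrable u m) {a b : ℝ} (hab : a ≤ b) :
    excess m u b + (b - a) * levelMeas m u b ≤ excess m u a := by
  have hi : Integrable ({x | b < |u x|}.indicator (fun _ => (1 : ℝ))) m :=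
    (integrable_const 1).indicator₀ (nullMeasurableSet_level hu.1 b)
  rw [← integral_indicator_one_level hu.1, excess, excess, ← integral_const_mul,
    ← integral_add (integrable_max_sub hu b) (hi.const_mul _)]
  refine integral_mono ((integrable_max_sub hu b).add (hi.const_mul _))
    (integrable_max_sub hu a) fun x => ?_
  by_cases h : b < |u x|
  · simp only [Set.indicator, Set.mem_ofPred_eq, h, if_true]
    rw [max_eq_left (by linarith), max_eq_left (by linarith)]; linarith
  · simp only [Set.indicator, Set.mem_ofPred_eq, h, if_false]
    rw [max_eq_right (by linarith)]; simp

theorem ae_abs_le_of_excess_eq_zero (hu : Integrable u m) {k : ℝ} (h : excess m u k = 0) :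
    ∀ᵐ x ∂m, |u x| ≤ k := by
  have := (integral_eq_zero_iff_of_nonneg (fun _ => le_max_right _ _)
    (integrable_max_sub hu k)).1 h
  filter_upwards [this] with x hx
  have : |u x| - k ≤ 0 := (le_max_left _ _).trans hx.le
  linarith

/-- Hölder's inequality on the set where `w` does not vanish. -/
theorem integral_le_rpow_mul_measureReal {w : α → ℝ} (hw : ∀ x, 0 ≤ w x)
    {s : Set α} (hs : NullMeasurableSet s m) (hws : ∀ x, x ∉ s → w x = 0) {r : ℝ} (hr : 1 ≤ r)
    (hwr : MemLp w (ENNReal.ofReal r) m) :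
    ∫ x, w x ∂m ≤ (∫ x, w x ^ r ∂m) ^ (1 / r) * m.real s ^ (1 - 1 / r) := by
  rcases hr.eq_or_lt with rfl | hr
  · simp
  have hc : r.HolderConjugate (Real.conjExponent r) := .conjExponent hr
  have hi : MemLp (s.indicator (fun _ => (1 : ℝ))) (ENNReal.ofReal (Real.conjExponent r)) m := by
    refine .of_bound (aestronglyMeasurable_const.indicator₀ hs) 1 (ae_of_all _ fun x => ?_)
    by_cases h : x ∈ s <;> simp [h]
  have := integral_mul_le_Lp_mul_Lq_of_nonneg hc (ae_of_all _ hw)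
    (ae_of_all _ fun x => Set.indicator_nonneg (fun _ _ => zero_le_one) x) hwr hi
  have h1 : ∀ x, w x * s.indicator (fun _ => (1 : ℝ)) x = w x := fun x => by
    by_cases h : x ∈ s <;> simp [h, hws]
  have h2 : ∀ x, s.indicator (fun _ => (1 : ℝ)) x ^ (Real.conjExponent r)
      = s.indicator (fun _ => (1 : ℝ)) x := fun x => by
    by_cases h : x ∈ s <;> simp [h, Real.zero_rpow hc.symm.pos.ne']
  simp_rw [h1, h2] at this
  rw [integral_indicator₀ hs] at this
  have h3 : 1 / Real.conjExponent r = 1 - 1 / r := by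
    have := hc.inv_add_inv_eq_one; simp only [one_div]; linarith
  simpa [h3, measureReal_def] using this

end Levels

/-! ### Closure properties of W^{1,p}_0. -/

/-- Dominated convergence in `L^p`. -/
theorem tendsto_eLpNorm_sub_of_dominated {α E : Type*} [MeasurableSpace α] [NormedAddCommGroup E]
    {m : Measure α} {p : ℝ} (hp : 1 ≤ p) {F : ℕ → α → E} {f : α → E} {g : α → ℝ}
    (hF : ∀ n, AEStronglyMeasurable (F n) m) (hf : AEStronglyMeasurable f m)
    (hg : MemLp g (ENNReal.ofReal p) m)
    (hbound : ∀ n, ∀ᵐ x ∂m, ‖F n x - f x‖ ≤ g x)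
    (hlim : ∀ᵐ x ∂m, Tendsto (fun n => F n x) atTop (𝓝 (f x))) :
    Tendsto (fun n => eLpNorm (fun x => F n x - f x) (ENNReal.ofReal p) m) atTop (𝓝 0) := by
  have hp0 : 0 < p := by linarith
  have h0 : ENNReal.ofReal p ≠ 0 := by simpa using hp0
  have hpt : (ENNReal.ofReal p).toReal = p := ENNReal.toReal_ofReal hp0.le
  have hfin : ∫⁻ x, ‖g x‖ₑ ^ p ∂m ≠ ⊤ := by
    have := (lintegral_rpow_enorm_lt_top_of_eLpNorm_lt_top h0 ENNReal.ofReal_ne_top hg.2).ne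
    rwa [hpt] at this
  have key : Tendsto (fun n => ∫⁻ x, ‖F n x - f x‖ₑ ^ p ∂m) atTop (𝓝 (∫⁻ _, 0 ∂m)) := by
    refine tendsto_lintegral_of_dominated_convergence' (fun x => ‖g x‖ₑ ^ p)
      (fun n => (((hF n).sub hf).enorm).pow_const p) (fun n => ?_) hfin ?_
    · filter_upwards [hbound n] with x hx
      have : ‖F n x - f x‖ₑ ≤ ‖g x‖ₑ :=
        enorm_le_iff_norm_le.2 (hx.trans (le_abs_self _))
      gcongr
    · filter_upwards [hlim] with x hx
      have h1 : Tendsto (fun n => ‖F n x - f x‖ₑ) atTop (𝓝 0) := by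
        have := (tendsto_iff_norm_sub_tendsto_zero.1 hx)
        rw [← tendsto_zero_iff_norm_tendsto_zero] at this
        simpa using this.enorm
      simpa [Function.comp_def, ENNReal.zero_rpow_of_pos hp0] using
        (ENNReal.continuous_rpow_const (y := p)).continuousAt.tendsto.comp h1
  simp only [eLpNorm_eq_lintegral_rpow_enorm_toReal h0 ENNReal.ofReal_ne_top, hpt]
  rw [lintegral_zero] at key
  have := (ENNReal.continuous_rpow_const (y := 1 / p)).continuousAt.tendsto.comp key
  simpa [Function.comp_def, ENNReal.zero_rpow_of_pos (inv_pos.2 hp0)] using this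

theorem norm_gradient_eq {E : Type*} [NormedAddCommGroup E] [InnerProductSpace ℝ E]
    [CompleteSpace E] (f : E → ℝ) (x : E) : ‖gradient f x‖ = ‖fderiv ℝ f x‖ := by
  simp [gradient]

section

variable {N : ℕ} {Ω : Set (RN N)} {p : ℝ} {u v : RN N → ℝ} {Du Dv : RN N → RN N}

theorem continuous_gradient {φ : RN N → ℝ} (hφ : ContDiff ℝ ∞ φ) : Continuous (gradient φ) := by
  unfold gradient
  exact (LinearIsometryEquiv.continuous _).comp (hφ.continuous_fderiv (by simp))

theorem gradient_comp {φ : RN N → ℝ} {η : ℝ → ℝ} (hη : Differentiable ℝ η)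
    (hφ : Differentiable ℝ φ) (x : RN N) :
    gradient (fun y => η (φ y)) x = deriv η (φ x) • gradient φ x := by
  have h : HasFDerivAt (fun y => η (φ y)) (deriv η (φ x) • fderiv ℝ φ x) x :=
    (hη (φ x)).hasDerivAt.comp_hasFDerivAt x (hφ x).hasFDerivAt
  simp [gradient, h.fderiv]

namespace MemW0

theorem zero : MemW0 Ω p (fun _ => 0) (fun _ => 0) where
  memLp := MemLp.zero'
  memLp_grad := MemLp.zero'
  approx := by
    refine ⟨fun _ _ => 0, fun n => ⟨contDiff_const, HasCompactSupport.zero, ?_⟩, ?_, ?_⟩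
    · simp [tsupport]
    · simp
    · simp

theorem exists_approx (h : MemW0 Ω p u Du) {ε : ENNReal} (hε : 0 < ε) :
    ∃ φ : RN N → ℝ, (ContDiff ℝ ∞ φ ∧ HasCompactSupport φ ∧ tsupport φ ⊆ Ω) ∧
      eLpNorm (fun x => φ x - u x) (ENNReal.ofReal p) (volume.restrict Ω) ≤ ε ∧
      eLpNorm (fun x => gradient φ x - Du x) (ENNReal.ofReal p) (volume.restrict Ω) ≤ ε := by
  obtain ⟨φ, h1, h2, h3⟩ := h.approx
  obtain ⟨n, hn⟩ := ((h2.eventually (eventually_lt_nhds hε)).and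
    (h3.eventually (eventually_lt_nhds hε))).exists
  exact ⟨φ n, h1 n, hn.1.le, hn.2.le⟩

/-- A diagonal choice: each `w n` is replaced by a test function at distance at most 1/(n+1) in both
norms. -/
theorem of_tendsto (hp : 1 ≤ p) {w : ℕ → RN N → ℝ} {Dw : ℕ → RN N → RN N}
    (hw : ∀ n, MemW0 Ω p (w n) (Dw n)) (hu : MemLp u (ENNReal.ofReal p) (volume.restrict Ω))
    (hDu : MemLp Du (ENNReal.ofReal p) (volume.restrict Ω))
    (hlim : Tendsto (fun n => eLpNorm (fun x => w n x - u x) (ENNReal.ofReal p)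
      (volume.restrict Ω)) atTop (𝓝 0))
    (hDlim : Tendsto (fun n => eLpNorm (fun x => Dw n x - Du x) (ENNReal.ofReal p)
      (volume.restrict Ω)) atTop (𝓝 0)) : MemW0 Ω p u Du := by
  have hp1 : 1 ≤ ENNReal.ofReal p := by simpa using hp
  have hε : Tendsto (fun n : ℕ => ((n : ENNReal) + 1)⁻¹) atTop (𝓝 0) := by
    simpa [Function.comp_def] using (ENNReal.tendsto_inv_nat_nhds_zero.comp (tendsto_add_atTop_nat 1))
  choose φ hφ hφ1 hφ2 using fun n =>
    (hw n).exists_approx (ε := ((n : ENNReal) + 1)⁻¹) (by simp)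
  refine ⟨hu, hDu, φ, hφ, ?_, ?_⟩
  · refine tendsto_of_tendsto_of_tendsto_of_le_of_le tendsto_const_nhds
      (by simpa using hε.add hlim) (fun _ => zero_le) fun n => ?_
    have := eLpNorm_add_le (((hφ n).1.continuous.aestronglyMeasurable.sub (hw n).memLp.1))
      ((hw n).memLp.1.sub hu.1) hp1
    refine le_trans (le_of_eq ?_) (this.trans (add_le_add (hφ1 n) le_rfl))
    congr 1; ext x; simp
  · refine tendsto_of_tendsto_of_tendsto_of_le_of_le tendsto_const_nhds
      (by simpa using hε.add hDlim) (fun _ => zero_le) fun n => ?_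
    have := eLpNorm_add_le
      ((continuous_gradient (hφ n).1).aestronglyMeasurable.sub (hw n).memLp_grad.1)
      ((hw n).memLp_grad.1.sub hDu.1) hp1
    refine le_trans (le_of_eq ?_) (this.trans (add_le_add (hφ2 n) le_rfl))
    congr 1; ext x; simp

theorem sub (hp : 1 ≤ p) (hu : MemW0 Ω p u Du) (hv : MemW0 Ω p v Dv) :
    MemW0 Ω p (fun x => u x - v x) (fun x => Du x - Dv x) := by
  have hp1 : 1 ≤ ENNReal.ofReal p := by simpa using hp
  obtain ⟨φ, hφ, hφ1, hφ2⟩ := hu.approx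
  obtain ⟨ψ, hψ, hψ1, hψ2⟩ := hv.approx
  refine ⟨hu.memLp.sub hv.memLp, hu.memLp_grad.sub hv.memLp_grad,
    fun n x => φ n x - ψ n x, fun n => ⟨(hφ n).1.sub (hψ n).1, (hφ n).2.1.sub (hψ n).2.1,
      (tsupport_sub (φ n) (ψ n)).trans (Set.union_subset (hφ n).2.2 (hψ n).2.2)⟩, ?_, ?_⟩
  · refine tendsto_of_tendsto_of_tendsto_of_le_of_le tendsto_const_nhds
      (by simpa using hφ1.add hψ1) (fun _ => zero_le) fun n => ?_
    have := eLpNorm_sub_le (((hφ n).1.continuous.aestronglyMeasurable.sub hu.memLp.1))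
      (((hψ n).1.continuous.aestronglyMeasurable.sub hv.memLp.1)) hp1
    refine le_trans (le_of_eq ?_) this
    congr 1; ext x; simp; ring
  · refine tendsto_of_tendsto_of_tendsto_of_le_of_le tendsto_const_nhds
      (by simpa using hφ2.add hψ2) (fun _ => zero_le) fun n => ?_
    have := eLpNorm_sub_le
      ((continuous_gradient (hφ n).1).aestronglyMeasurable.sub hu.memLp_grad.1)
      ((continuous_gradient (hψ n).1).aestronglyMeasurable.sub hv.memLp_grad.1) hp1
    refine le_trans (le_of_eq ?_) this
    congr 1; ext x : 1
    have : gradient (fun x => φ n x - ψ n x) x = gradient (φ n) x - gradient (ψ n) x := by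
      simp [gradient, fderiv_fun_sub ((hφ n).1.differentiable (by simp) x)
        ((hψ n).1.differentiable (by simp) x)]
    rw [this]
    simp only [Pi.sub_apply]
    abel

theorem exists_approx_ae (hp : 1 ≤ p) (h : MemW0 Ω p u Du) : ∃ φ : ℕ → RN N → ℝ,
    (∀ n, ContDiff ℝ ∞ (φ n) ∧ HasCompactSupport (φ n) ∧ tsupport (φ n) ⊆ Ω) ∧
    Tendsto (fun n => eLpNorm (fun x => φ n x - u x) (ENNReal.ofReal p) (volume.restrict Ω))
      atTop (𝓝 0) ∧
    Tendsto (fun n => eLpNorm (fun x => gradient (φ n) x - Du x) (ENNReal.ofReal p)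
      (volume.restrict Ω)) atTop (𝓝 0) ∧
    ∀ᵐ x ∂(volume.restrict Ω), Tendsto (fun n => φ n x) atTop (𝓝 (u x)) := by
  have h0 : ENNReal.ofReal p ≠ 0 := by simp; linarith
  obtain ⟨φ, h1, h2, h3⟩ := h.approx
  obtain ⟨ns, hns, hae⟩ := (tendstoInMeasure_of_tendsto_eLpNorm h0
    (fun n => (h1 n).1.continuous.aestronglyMeasurable) h.memLp.1 h2).exists_seq_tendsto_ae
  exact ⟨fun n => φ (ns n), fun n => h1 _, h2.comp hns.tendsto_atTop, h3.comp hns.tendsto_atTop,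
    hae⟩

/-- For test functions φₙ, ∇(η∘φₙ) - η'(u)Du = η'(φₙ)(∇φₙ - Du) + (η'(φₙ) - η'(u))Du. The first term
is small since |η'| ≤ 1, the second by dominated convergence along an a.e. convergent subsequence.
The condition η(0) = 0 keeps the supports in Ω. -/
theorem comp_smooth (hp : 1 ≤ p) (h : MemW0 Ω p u Du) {η : ℝ → ℝ} (hη : ContDiff ℝ ∞ η)
    (hη0 : η 0 = 0) (hη1 : ∀ t, |deriv η t| ≤ 1) :
    MemW0 Ω p (fun x => η (u x)) (fun x => deriv η (u x) • Du x) := by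
  have hp1 : 1 ≤ ENNReal.ofReal p := by simpa using hp
  have hd : Differentiable ℝ η := hη.differentiable (by simp)
  have hc : Continuous (deriv η) := hη.continuous_deriv (by simp)
  have hlip : ∀ a b, ‖η a - η b‖ ≤ ‖a - b‖ := fun a b => by
    have := Convex.norm_image_sub_le_of_norm_deriv_le (f := η) (C := 1)
      (fun x _ => hd x) (fun x _ => hη1 x) convex_univ (Set.mem_univ b) (Set.mem_univ a)
    simpa using this
  obtain ⟨φ, hφ, h1, h2, hae⟩ := h.exists_approx_ae hp
  have hmg : AEStronglyMeasurable (fun x => deriv η (u x)) (volume.restrict Ω) :=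
    hc.comp_aestronglyMeasurable h.memLp.1
  refine ⟨h.memLp.mono (hη.continuous.comp_aestronglyMeasurable h.memLp.1)
      (ae_of_all _ fun x => by simpa [hη0] using hlip (u x) 0),
    h.memLp_grad.mono (hmg.smul h.memLp_grad.1) (ae_of_all _ fun x => ?_),
    fun n x => η (φ n x), fun n => ⟨hη.comp (hφ n).1, (hφ n).2.1.comp_left hη0,
      (tsupport_comp_subset hη0 (φ n)).trans (hφ n).2.2⟩, ?_, ?_⟩
  · rw [norm_smul]
    exact mul_le_of_le_one_left (norm_nonneg _) (hη1 _)
  · refine tendsto_of_tendsto_of_tendsto_of_le_of_le tendsto_const_nhds h1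
      (fun _ => zero_le) fun n => eLpNorm_mono fun x => hlip _ _
  · have hdct := tendsto_eLpNorm_sub_of_dominated hp (m := volume.restrict Ω)
      (F := fun n x => deriv η (φ n x) • Du x) (f := fun x => deriv η (u x) • Du x)
      (g := fun x => 2 * ‖Du x‖)
      (fun n => (hc.comp_aestronglyMeasurable
        (hφ n).1.continuous.aestronglyMeasurable).smul h.memLp_grad.1) (hmg.smul h.memLp_grad.1)
      (h.memLp_grad.norm.const_mul 2)
      (fun n => ae_of_all _ fun x => by
        rw [← sub_smul, norm_smul]
        gcongr
        refine (abs_sub _ _).trans ?_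
        linarith [hη1 (φ n x), hη1 (u x)])
      (by
        filter_upwards [hae] with x hx
        exact ((hc.tendsto _).comp hx).smul_const _)
    refine tendsto_of_tendsto_of_tendsto_of_le_of_le tendsto_const_nhds
      (by simpa using h2.add hdct) (fun _ => zero_le) fun n => ?_
    have hm1 : AEStronglyMeasurable (fun x => deriv η (φ n x) • (gradient (φ n) x - Du x))
        (volume.restrict Ω) :=
      (hc.comp_aestronglyMeasurable (hφ n).1.continuous.aestronglyMeasurable).smul
        ((continuous_gradient (hφ n).1).aestronglyMeasurable.sub h.memLp_grad.1)
    have hm2 : AEStronglyMeasurable (fun x => deriv η (φ n x) • Du x - deriv η (u x) • Du x)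
        (volume.restrict Ω) :=
      ((hc.comp_aestronglyMeasurable
        (hφ n).1.continuous.aestronglyMeasurable).smul h.memLp_grad.1).sub
        (hmg.smul h.memLp_grad.1)
    have := eLpNorm_add_le hm1 hm2 hp1
    refine le_trans (le_of_eq ?_) (this.trans (add_le_add (eLpNorm_mono fun x => ?_) le_rfl))
    · congr 1; ext x : 1
      rw [gradient_comp hd ((hφ n).1.differentiable (by simp))]
      simp only [Pi.add_apply, smul_sub]
      abel
    · rw [norm_smul]
      exact mul_le_of_le_one_left (norm_nonneg _) (hη1 _)

end MemW0

end

/-! ### Truncations. -/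

/-- The truncation of a real number at the levels `± k`. -/
noncomputable def trunc (k t : ℝ) : ℝ := max (-k) (min t k)

theorem trunc_of_abs_le {k t : ℝ} (h : |t| ≤ k) : trunc k t = t := by
  rw [abs_le] at h
  rw [trunc, min_eq_left h.2, max_eq_right h.1]

theorem abs_trunc_le {k t : ℝ} (hk : 0 ≤ k) : |trunc k t| ≤ k := by
  rw [trunc, abs_le]
  exact ⟨le_max_left _ _, max_le (by linarith) (min_le_right _ _)⟩

theorem continuous_trunc (k : ℝ) : Continuous (trunc k) := by
  unfold trunc; fun_prop

/-- The sign is displayed because the growth condition bounds sign(t) f only; multiplying it by (|t|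
- k)⁺ then estimates f(x,u)(u - T_k u). -/
theorem sub_trunc {k t : ℝ} (hk : 0 ≤ k) : t - trunc k t = Real.sign t * max (|t| - k) 0 := by
  rcases le_or_gt |t| k with h | h
  · rw [trunc_of_abs_le h, max_eq_right (by linarith)]; simp
  · rw [max_eq_left (by linarith)]
    rcases lt_abs.1 h with h | h
    · rw [Real.sign_of_pos (by linarith), abs_of_pos (by linarith), trunc, min_eq_right h.le,
        max_eq_right (by linarith)]; ring
    · rw [Real.sign_of_neg (by linarith), abs_of_neg (by linarith), trunc,
        min_eq_left (by linarith), max_eq_left (by linarith)]; ring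

theorem abs_sub_trunc {k t : ℝ} (hk : 0 ≤ k) : |t - trunc k t| = max (|t| - k) 0 := by
  rw [sub_trunc hk, abs_mul, abs_of_nonneg (le_max_right (|t| - k) 0)]
  rcases le_or_gt |t| k with h | h
  · rw [max_eq_right (by linarith)]; simp
  · have : t ≠ 0 := by rintro rfl; simp at h; linarith
    rcases Real.sign_apply_eq_of_ne_zero t this with h | h <;> simp [h]

theorem abs_trunc_le_abs {k t : ℝ} (hk : 0 ≤ k) : |trunc k t| ≤ |t| := by
  rcases le_or_gt |t| k with h | h
  · rw [trunc_of_abs_le h]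
  · exact (abs_trunc_le hk).trans h.le

/-- A smooth bump function equal to `1` on `[-k, k]` and vanishing outside of
`[-k - 1 / (n + 1), k + 1 / (n + 1)]`. -/
noncomputable def levelBump (k : ℝ) (hk : 0 < k) (n : ℕ) : ContDiffBump (0 : ℝ) where
  rIn := k
  rOut := k + 1 / (n + 1)
  rIn_pos := hk
  rIn_lt_rOut := by have : (0 : ℝ) < 1 / (n + 1) := by positivity
                    linarith

theorem levelBump_of_abs_le {k : ℝ} (hk : 0 < k) (n : ℕ) {t : ℝ} (ht : |t| ≤ k) :
    levelBump k hk n t = 1 :=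
  (levelBump k hk n).one_of_mem_closedBall (by simpa [levelBump] using ht)

theorem eventually_levelBump_eq_zero {k : ℝ} (hk : 0 < k) {t : ℝ} (ht : k < |t|) :
    ∀ᶠ n : ℕ in atTop, levelBump k hk n t = 0 := by
  filter_upwards [tendsto_one_div_add_atTop_nhds_zero_nat.eventually
    (eventually_lt_nhds (sub_pos.2 ht))] with n hn
  refine (levelBump k hk n).zero_of_le_dist ?_
  simp only [levelBump, dist_zero_right, Real.norm_eq_abs]
  linarith

theorem abs_levelBump_le {k : ℝ} (hk : 0 < k) (n : ℕ) (t : ℝ) : |levelBump k hk n t| ≤ 1 := by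
  rw [abs_of_nonneg (ContDiffBump.nonneg _)]
  exact ContDiffBump.le_one _

/-- Smooth approximations of the truncation. -/
noncomputable def smoothTrunc (k : ℝ) (hk : 0 < k) (n : ℕ) (t : ℝ) : ℝ :=
  ∫ s in (0 : ℝ)..t, levelBump k hk n s

theorem deriv_smoothTrunc {k : ℝ} (hk : 0 < k) (n : ℕ) :
    deriv (smoothTrunc k hk n) = levelBump k hk n := by
  ext t
  exact (levelBump k hk n).continuous.deriv_integral _ 0 t

theorem contDiff_smoothTrunc {k : ℝ} (hk : 0 < k) (n : ℕ) :
    ContDiff ℝ ∞ (smoothTrunc k hk n) := by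
  rw [contDiff_infty_iff_deriv]
  refine ⟨fun t => ?_, by rw [deriv_smoothTrunc]; exact (levelBump k hk n).contDiff⟩
  exact ((levelBump k hk n).continuous.integral_hasStrictDerivAt 0 t).hasDerivAt.differentiableAt

theorem abs_smoothTrunc_le {k : ℝ} (hk : 0 < k) (n : ℕ) (t : ℝ) :
    |smoothTrunc k hk n t| ≤ |t| := by
  have := intervalIntegral.norm_integral_le_of_norm_le_const (a := 0) (b := t) (C := 1)
    (f := levelBump k hk n) (fun s _ => abs_levelBump_le hk n s)
  simpa [smoothTrunc] using this

theorem tendsto_smoothTrunc {k : ℝ} (hk : 0 < k) (t : ℝ) :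
    Tendsto (fun n => smoothTrunc k hk n t) atTop (𝓝 (trunc k t)) := by
  have hint : ∀ n a b, IntervalIntegrable (levelBump k hk n) volume a b := fun n a b =>
    (levelBump k hk n).continuous.intervalIntegrable a b
  have h1 : ∀ n, smoothTrunc k hk n t
      = trunc k t + ∫ s in (trunc k t)..t, levelBump k hk n s := fun n => by
    rw [smoothTrunc, ← intervalIntegral.integral_add_adjacent_intervals (hint n 0 (trunc k t))
      (hint n (trunc k t) t)]
    congr 1
    have : ∀ s ∈ Set.uIcc 0 (trunc k t), levelBump k hk n s = 1 := fun s hs => by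
      refine levelBump_of_abs_le hk n ?_
      have hT := abs_le.1 (abs_trunc_le hk.le (t := t))
      rw [Set.mem_uIcc] at hs
      rw [abs_le]
      rcases hs with hs | hs <;> constructor <;> linarith [hs.1, hs.2]
    rw [intervalIntegral.integral_congr (g := fun _ => 1) this]
    simp
  have h2 : Tendsto (fun n => ∫ s in (trunc k t)..t, levelBump k hk n s) atTop
      (𝓝 (∫ _ in (trunc k t)..t, (0 : ℝ))) := by
    refine intervalIntegral.tendsto_integral_filter_of_dominated_convergence (fun _ => 1)
      (Eventually.of_forall fun n => (levelBump k hk n).continuous.aestronglyMeasurable)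
      (Eventually.of_forall fun n => ae_of_all _ fun s _ => abs_levelBump_le hk n s)
      (by simp) ?_
    -- For t < -k the half-open interval is (t, -k]; its endpoint -k, where every bump equals 1,
    -- must be discarded.
    have hne : ∀ᵐ s : ℝ, s ≠ -k := by simp [ae_iff]
    filter_upwards [hne] with s hs hsI
    refine tendsto_const_nhds.congr' ?_
    have hks : k < |s| := by
      rw [lt_abs]
      rw [Set.mem_uIoc] at hsI
      rcases le_or_gt |t| k with h | h
      · rw [trunc_of_abs_le h] at hsI
        rcases hsI with h | h <;> linarith [h.1, h.2]
      · rcases lt_abs.1 h with h | h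
        · have hT : trunc k t = k := by
            rw [trunc, min_eq_right h.le, max_eq_right (by linarith)]
          rw [hT] at hsI
          rcases hsI with h | h
          · exact Or.inl h.1
          · linarith [h.1, h.2]
        · have hT : trunc k t = -k := by
            rw [trunc, min_eq_left (by linarith), max_eq_left (by linarith)]
          rw [hT] at hsI
          rcases hsI with h | h
          · linarith [h.1, h.2]
          · have := lt_of_le_of_ne h.2 hs
            right; linarith
    filter_upwards [eventually_levelBump_eq_zero hk hks] with n hn using hn.symm
  simp_rw [h1]
  simpa using h2.const_add (trunc k t)

section

variable {N : ℕ} {Ω : Set (RN N)} {p : ℝ} {u v : RN N → ℝ} {Du Dv : RN N → RN N}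

namespace MemW0

/-- Truncations of `u ∈ W^{1,p}_0(Ω)` are in `W^{1,p}_0(Ω)`. -/
theorem trunc (hp : 1 ≤ p) (h : MemW0 Ω p u Du) {k : ℝ} (hk : 0 < k) :
    MemW0 Ω p (fun x => trunc k (u x)) ({x | |u x| ≤ k}.indicator Du) := by
  have hs : NullMeasurableSet {x | |u x| ≤ k} (volume.restrict Ω) :=
    nullMeasurableSet_le h.memLp.1.norm.aemeasurable aemeasurable_const
  have hw : ∀ n, MemW0 Ω p (fun x => smoothTrunc k hk n (u x))
      (fun x => levelBump k hk n (u x) • Du x) := fun n => by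
    have := h.comp_smooth hp (contDiff_smoothTrunc hk n) (by simp [smoothTrunc])
      (fun t => by rw [deriv_smoothTrunc]; exact abs_levelBump_le hk n t)
    simpa only [deriv_smoothTrunc] using this
  have hm : AEStronglyMeasurable (fun x => _root_.trunc k (u x)) (volume.restrict Ω) :=
    (continuous_trunc k).comp_aestronglyMeasurable h.memLp.1
  have hmD := h.memLp_grad.1.indicator₀ hs
  have hind : ∀ x, ‖({x | |u x| ≤ k}.indicator Du) x‖ ≤ ‖Du x‖ := fun x =>
    norm_indicator_le_norm_self _ _
  refine of_tendsto hp hw (h.memLp.mono hm (ae_of_all _ fun x => abs_trunc_le_abs hk.le))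
    (h.memLp_grad.mono hmD (ae_of_all _ hind)) ?_ ?_
  · refine tendsto_eLpNorm_sub_of_dominated hp (fun n => (hw n).memLp.1) hm
      (h.memLp.norm.const_mul 2) (fun n => ae_of_all _ fun x => ?_)
      (ae_of_all _ fun x => tendsto_smoothTrunc hk (u x))
    refine (abs_sub _ _).trans ?_
    have := abs_smoothTrunc_le hk n (u x)
    have := abs_trunc_le_abs hk.le (t := u x)
    rw [Real.norm_eq_abs]; linarith
  · refine tendsto_eLpNorm_sub_of_dominated hp (fun n => (hw n).memLp_grad.1) hmD
      (h.memLp_grad.norm.const_mul 2) (fun n => ae_of_all _ fun x => ?_)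
      (ae_of_all _ fun x => ?_)
    · refine (norm_sub_le _ _).trans ?_
      have : ‖levelBump k hk n (u x) • Du x‖ ≤ ‖Du x‖ := by
        rw [norm_smul]
        exact mul_le_of_le_one_left (norm_nonneg _) (abs_levelBump_le hk n _)
      linarith [hind x]
    -- The bumps equal 1 on the closed interval, so the limit is Du also where |u| = k; whether Du
    -- vanishes on that level set plays no role.
    · by_cases hx : |u x| ≤ k
      · simp [hx, levelBump_of_abs_le hk]
      · rw [Set.indicator_of_notMem (by simpa using hx)]
        refine tendsto_const_nhds.congr' ?_
        filter_upwards [eventually_levelBump_eq_zero hk (not_le.1 hx)] with n hn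
        simp [hn]

theorem sub_trunc (hp : 1 ≤ p) (h : MemW0 Ω p u Du) {k : ℝ} (hk : 0 < k) :
    MemW0 Ω p (fun x => u x - _root_.trunc k (u x)) ({x | k < |u x|}.indicator Du) := by
  have := h.sub hp (h.trunc hp hk)
  convert this using 2 with x
  by_cases hx : k < |u x|
  · simp [hx, not_le.2 hx]
  · simp [hx, not_lt.1 hx]

end MemW0

end

/-! ### Sobolev inequalities above a level. -/

section Sobolev

/-- The fundamental theorem of calculus on a half-line, transported by an isometry. It gives the
W^{1,1} inequality for N = 1, where N/(N-1) is ∞. -/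
theorem HasCompactSupport.enorm_le_lintegral_fderiv_fin_one {φ : RN 1 → ℝ}
    (hφ : ContDiff ℝ 1 φ) (hc : HasCompactSupport φ) (x : RN 1) :
    ‖φ x‖ₑ ≤ ∫⁻ y, ‖fderiv ℝ φ y‖ₑ := by
  let L : ℝ ≃ₗᵢ[ℝ] RN 1 := (OrthonormalBasis.singleton (Fin 1) ℝ).repr
  have hg : ContDiff ℝ 1 (φ ∘ L) := hφ.comp L.contDiff
  have hgc : HasCompactSupport (φ ∘ L) := hc.comp_homeomorph L.toHomeomorph
  have h1 := hgc.enorm_le_lintegral_Ici_deriv hg (L.symm x)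
  simp only [Function.comp_apply, LinearIsometryEquiv.apply_symm_apply] at h1
  refine h1.trans ?_
  calc ∫⁻ y in Set.Iic (L.symm x), ‖deriv (φ ∘ L) y‖ₑ ≤ ∫⁻ y, ‖deriv (φ ∘ L) y‖ₑ :=
        setLIntegral_le_lintegral _ _
    _ ≤ ∫⁻ y, ‖fderiv ℝ φ (L y)‖ₑ := by
        refine lintegral_mono fun y => enorm_le_iff_norm_le.2 ?_
        have : HasDerivAt (φ ∘ L) (fderiv ℝ φ (L y) (L 1)) y := by
          have h2 : HasDerivAt L (L 1) y := by
            have := (L.toContinuousLinearEquiv : ℝ →L[ℝ] RN 1).hasDerivAt (x := y)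
            simpa using this
          exact (hφ.differentiable one_ne_zero (L y)).hasFDerivAt.comp_hasDerivAt y h2
        rw [this.deriv]
        refine ((fderiv ℝ φ (L y)).le_opNorm _).trans ?_
        simp
    _ = ∫⁻ y, ‖fderiv ℝ φ y‖ₑ :=
        L.measurePreserving.lintegral_comp_emb L.toHomeomorph.measurableEmbedding
          (fun y => ‖fderiv ℝ φ y‖ₑ)

end Sobolev

theorem eLpNorm_le_mul_rpow_of_support_subset {α E : Type*} [MeasurableSpace α]
    [NormedAddCommGroup E] {m : Measure α} {w : α → E} {s : Set α} {p q : ENNReal} (hpq : p ≤ q)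
    (hw : AEStronglyMeasurable w m) (hs : Function.support w ⊆ s) :
    eLpNorm w p m ≤ eLpNorm w q m * m s ^ (1 / p.toReal - 1 / q.toReal) := by
  have := eLpNorm_le_eLpNorm_mul_rpow_measure_univ hpq (hw.restrict (s := s))
  rwa [eLpNorm_restrict_eq_of_support_subset hs, eLpNorm_restrict_eq_of_support_subset hs,
    Measure.restrict_apply_univ] at this

/-- The integral of `|Du|^p` over `{|u| > k}`. -/
noncomputable def levelEnergy {N : ℕ} (m : Measure (RN N)) (p : ℝ) (u : RN N → ℝ)
    (Du : RN N → RN N) (k : ℝ) : ℝ := ∫ x, ‖{x | k < |u x|}.indicator Du x‖ ^ p ∂m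

section

variable {N : ℕ} {Ω : Set (RN N)} {p : ℝ} {u v : RN N → ℝ} {Du Dv : RN N → RN N}

theorem levelEnergy_nonneg {m : Measure (RN N)} (k : ℝ) : 0 ≤ levelEnergy m p u Du k :=
  integral_nonneg fun _ => by positivity

theorem eLpNorm_gradient_restrict {φ : RN N → ℝ} (hφ : tsupport φ ⊆ Ω) (q : ENNReal) :
    eLpNorm (fderiv ℝ φ) q volume = eLpNorm (gradient φ) q (volume.restrict Ω) := by
  rw [← eLpNorm_restrict_eq_of_support_subset (f := fderiv ℝ φ)
    ((support_fderiv_subset ℝ).trans hφ)]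
  exact eLpNorm_congr_norm_ae (ae_of_all _ fun x => (norm_gradient_eq φ x).symm)

/-- Sobolev inequalities for test functions extend to `W^{1,p}_0(Ω)`. -/
theorem MemW0.eLpNorm_le_of_forall_test (hp : 1 ≤ p) (hΩ : volume Ω < ⊤) (h : MemW0 Ω p u Du)
    {r : ENNReal} {p' : ℝ} (hp' : 1 ≤ p') (hpp' : p' ≤ p) {S : NNReal}
    (hS : ∀ φ : RN N → ℝ, ContDiff ℝ ∞ φ → HasCompactSupport φ →
      eLpNorm φ r volume ≤ S * eLpNorm (fderiv ℝ φ) (ENNReal.ofReal p') volume) :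
    eLpNorm u r (volume.restrict Ω) ≤ S * eLpNorm Du (ENNReal.ofReal p') (volume.restrict Ω) := by
  obtain ⟨φ, hφ, h1, h2, hae⟩ := h.exists_approx_ae hp
  have hp1 : 1 ≤ ENNReal.ofReal p' := by simpa using hp'
  have hm := fun n => (continuous_gradient (hφ n).1).aestronglyMeasurable (μ := volume.restrict Ω)
  set a : ℝ := 1 / (ENNReal.ofReal p').toReal - 1 / (ENNReal.ofReal p).toReal with ha
  have ha0 : 0 ≤ a := by
    rw [ha, ENNReal.toReal_ofReal (by linarith), ENNReal.toReal_ofReal (by linarith)]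
    exact sub_nonneg.2 (one_div_le_one_div_of_le (by linarith) hpp')
  have hV : (volume Ω) ^ a ≠ ⊤ := ENNReal.rpow_ne_top_of_nonneg ha0 hΩ.ne
  have hle : ∀ n, eLpNorm (φ n) r (volume.restrict Ω) ≤
      S * (eLpNorm (fun x => gradient (φ n) x - Du x) (ENNReal.ofReal p) (volume.restrict Ω)
        * (volume Ω) ^ a + eLpNorm Du (ENNReal.ofReal p') (volume.restrict Ω)) := fun n => by
    refine (eLpNorm_mono_measure _ Measure.restrict_le_self).trans
      ((hS _ (hφ n).1 (hφ n).2.1).trans ?_)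
    rw [eLpNorm_gradient_restrict (hφ n).2.2]
    gcongr
    have h3 := eLpNorm_add_le ((hm n).sub h.memLp_grad.1) h.memLp_grad.1 hp1
    have h4 := eLpNorm_le_eLpNorm_mul_rpow_measure_univ (ENNReal.ofReal_le_ofReal hpp')
      ((hm n).sub h.memLp_grad.1)
    rw [Measure.restrict_apply_univ] at h4
    rw [sub_add_cancel] at h3
    exact h3.trans (add_le_add h4 le_rfl)
  have hlim : Tendsto (fun n => (S : ENNReal) *
      (eLpNorm (fun x => gradient (φ n) x - Du x) (ENNReal.ofReal p) (volume.restrict Ω)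
        * (volume Ω) ^ a + eLpNorm Du (ENNReal.ofReal p') (volume.restrict Ω))) atTop
      (𝓝 (S * (0 * (volume Ω) ^ a + eLpNorm Du (ENNReal.ofReal p') (volume.restrict Ω)))) :=
    ENNReal.Tendsto.const_mul ((ENNReal.Tendsto.mul_const h2 (Or.inr hV)).add_const _)
      (Or.inr ENNReal.coe_ne_top)
  rw [zero_mul, zero_add] at hlim
  -- Fatou along the a.e. convergent sequence; no prior membership of u in L^r is needed, and r = ∞
  -- is covered.
  calc eLpNorm u r (volume.restrict Ω)
      ≤ liminf (fun n => eLpNorm (φ n) r (volume.restrict Ω)) atTop :=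
        Lp.eLpNorm_lim_le_liminf_eLpNorm
          (fun n => (hφ n).1.continuous.aestronglyMeasurable) u hae
    _ ≤ _ := (liminf_le_liminf (Eventually.of_forall hle)).trans hlim.liminf_eq.le

theorem eLpNorm_top_le_of_dim_one {φ : RN 1 → ℝ} (hφ : ContDiff ℝ ∞ φ)
    (hc : HasCompactSupport φ) :
    eLpNorm φ ⊤ volume ≤ eLpNorm (fderiv ℝ φ) (ENNReal.ofReal 1) volume := by
  rw [eLpNorm_exponent_top, ENNReal.ofReal_one, eLpNorm_one_eq_lintegral_enorm]
  exact eLpNormEssSup_le_of_ae_enorm_bound (ae_of_all _ fun x =>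
    hc.enorm_le_lintegral_fderiv_fin_one (hφ.of_le (by simp)) x)

/-- The Sobolev inequality for `W^{1,1}_0`, in all dimensions. -/
theorem exists_sobolev_one (N : ℕ) (hN : 1 ≤ N) : ∃ (q : ENNReal) (S : NNReal), 1 ≤ q ∧
    1 - 1 / q.toReal = 1 / N ∧ ∀ φ : RN N → ℝ, ContDiff ℝ ∞ φ → HasCompactSupport φ →
      eLpNorm φ q volume ≤ S * eLpNorm (fderiv ℝ φ) (ENNReal.ofReal 1) volume := by
  rcases hN.eq_or_lt with rfl | hN
  -- Since `⊤.toReal = 0` and 1/0 = 0, the exponent identity reads 1 = 1/N.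
  · refine ⟨⊤, 1, le_top, by simp, fun φ hφ hc => ?_⟩
    rw [ENNReal.coe_one, one_mul]
    exact eLpNorm_top_le_of_dim_one hφ hc
  · have hc := NNReal.HolderConjugate.conjExponent (p := N) (by exact_mod_cast hN)
    refine ⟨NNReal.conjExponent N, eLpNormLESNormFDerivOneConst (volume : Measure (RN N)) (NNReal.conjExponent N),
      ?_, ?_, fun φ hφ hc' => ?_⟩
    · exact_mod_cast hc.symm.lt.le
    · have := hc.coe.inv_add_inv_eq_one
      simp only [one_div, ENNReal.coe_toReal]
      simp only [NNReal.coe_natCast] at this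
      linarith
    · rw [ENNReal.ofReal_one]
      refine eLpNorm_le_eLpNorm_fderiv_one volume (hφ.of_le (by simp)) hc' ?_
      simpa using hc

theorem MemW0.levelEnergy_rpow (hp : 1 ≤ p) (h : MemW0 Ω p u Du) {k : ℝ} (hk : 0 < k) :
    eLpNorm ({x | k < |u x|}.indicator Du) (ENNReal.ofReal p) (volume.restrict Ω)
      = ENNReal.ofReal (levelEnergy (volume.restrict Ω) p u Du k ^ (1 / p)) := by
  rw [MemLp.eLpNorm_eq_integral_rpow_norm (by simp; linarith) ENNReal.ofReal_ne_top
    (h.sub_trunc hp hk).memLp_grad, ENNReal.toReal_ofReal (by linarith), one_div]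
  rfl

theorem MemW0.integrable [IsFiniteMeasure (volume.restrict Ω)] (hp : 1 ≤ p) (h : MemW0 Ω p u Du) :
    Integrable u (volume.restrict Ω) :=
  h.memLp.integrable (by simpa using hp)

theorem ofReal_excess {α : Type*} [MeasurableSpace α] {m : Measure α} [IsFiniteMeasure m]
    {u : α → ℝ} (hu : Integrable u m) {k : ℝ} (hk : 0 ≤ k) :
    ENNReal.ofReal (excess m u k) = eLpNorm (fun x => u x - trunc k (u x)) 1 m := by
  rw [excess, ofReal_integral_eq_lintegral_ofReal (integrable_max_sub hu k)
    (ae_of_all _ fun _ => le_max_right _ _), eLpNorm_one_eq_lintegral_enorm]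
  refine lintegral_congr fun x => ?_
  rw [← abs_sub_trunc hk, ← Real.enorm_eq_ofReal_abs]

theorem support_sub_trunc {α : Type*} (u : α → ℝ) (k : ℝ) :
    (Function.support fun x => u x - trunc k (u x)) ⊆ {x | k < |u x|} := by
  intro x hx
  by_contra hlt
  exact hx (by simp [trunc_of_abs_le (not_lt.1 hlt)])

/-- An upper bound of the mean excess over the level `k` by the energy above this level. -/
theorem exists_excess_le (N : ℕ) (hN : 1 ≤ N) : ∃ C : ℝ, 0 < C ∧
    ∀ (Ω : Set (RN N)) (p : ℝ) (u : RN N → ℝ) (Du : RN N → RN N) (k : ℝ), volume Ω < ⊤ → 1 ≤ p →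
      MemW0 Ω p u Du → 0 < k → excess (volume.restrict Ω) u k ^ p ≤
        C ^ p * levelMeas (volume.restrict Ω) u k ^ (p - 1 + p / N) *
          levelEnergy (volume.restrict Ω) p u Du k := by
  obtain ⟨q, S, hq, hqN, hS⟩ := exists_sobolev_one N hN
  refine ⟨S + 1, by positivity, fun Ω p u Du k hΩ hp h hk => ?_⟩
  have : IsFiniteMeasure (volume.restrict Ω) := ⟨by simpa using hΩ⟩
  set m := volume.restrict Ω with hm
  have hp0 : 0 < p := by linarith
  have hw := h.sub_trunc hp hk
  have hint := h.integrable hp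
  set w := fun x => u x - trunc k (u x) with hwdef
  set s := {x | k < |u x|} with hs
  have hms : m s = ENNReal.ofReal (levelMeas m u k) := by
    rw [levelMeas, measureReal_def, ENNReal.ofReal_toReal (measure_ne_top _ _)]
  -- Hölder, Sobolev, Hölder: A enters with exponents 1/N and 1 - 1/p, and the p-th power turns
  -- their sum into p - 1 + p/N. Only the W^{1,1} inequality is used, so C does not depend on p.
  have e1 : eLpNorm w 1 m ≤ eLpNorm w q m * m s ^ (1 / (N : ℝ)) := by
    have := eLpNorm_le_mul_rpow_of_support_subset hq hw.memLp.1 (support_sub_trunc u k)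
    simpa [← hqN] using this
  have e2 : eLpNorm w q m ≤ S * eLpNorm (s.indicator Du) 1 m := by
    have := hw.eLpNorm_le_of_forall_test hp hΩ le_rfl hp hS
    rwa [ENNReal.ofReal_one] at this
  have e3 : eLpNorm (s.indicator Du) 1 m ≤
      eLpNorm (s.indicator Du) (ENNReal.ofReal p) m * m s ^ (1 - 1 / p) := by
    have := eLpNorm_le_mul_rpow_of_support_subset (p := 1) (q := ENNReal.ofReal p)
      (by simpa using hp) hw.memLp_grad.1 (Set.support_indicator_subset (s := s) (f := Du))
    simpa [ENNReal.toReal_ofReal hp0.le] using this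
  have hA := levelMeas_nonneg (m := m) (u := u) k
  have hG := levelEnergy_nonneg (m := m) (p := p) (u := u) (Du := Du) k
  rw [h.levelEnergy_rpow hp hk] at e3
  set A := levelMeas m u k
  set G := levelEnergy m p u Du k
  have hp1 : 0 ≤ 1 - 1 / p := by
    rw [sub_nonneg, div_le_one hp0]; exact hp
  have key : ENNReal.ofReal (excess m u k) ≤
      ENNReal.ofReal (S * (G ^ (1 / p) * A ^ (1 - 1 / p)) * A ^ (1 / (N : ℝ))) := by
    rw [ofReal_excess hint hk.le]
    refine e1.trans ((mul_le_mul_left (e2.trans (mul_le_mul_right e3 _)) _).trans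
      (le_of_eq ?_))
    rw [hms, ENNReal.ofReal_rpow_of_nonneg hA hp1, ENNReal.ofReal_rpow_of_nonneg hA (by positivity),
      ENNReal.ofReal_mul (by positivity), ENNReal.ofReal_mul (by positivity),
      ENNReal.ofReal_mul (by positivity), ENNReal.ofReal_coe_nnreal]
  rw [ENNReal.ofReal_le_ofReal_iff (by positivity)] at key
  calc excess m u k ^ p ≤ (S * (G ^ (1 / p) * A ^ (1 - 1 / p)) * A ^ (1 / (N : ℝ))) ^ p :=
        Real.rpow_le_rpow (excess_nonneg k) key hp0.le
    _ = (S : ℝ) ^ p * A ^ (p - 1 + p / N) * G := by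
        rw [Real.mul_rpow (by positivity) (by positivity),
          Real.mul_rpow (by positivity) (by positivity),
          Real.mul_rpow (by positivity) (by positivity), ← Real.rpow_mul hG,
          ← Real.rpow_mul hA, ← Real.rpow_mul hA, Real.rpow_add_of_nonneg hA (by linarith)
          (by positivity)]
        rw [one_div_mul_cancel hp0.ne', Real.rpow_one]
        have h1 : (1 - 1 / p) * p = p - 1 := by field_simp
        have h2 : 1 / (N : ℝ) * p = p / N := by ring
        rw [h1, h2]; ring
    _ ≤ (S + 1 : ℝ) ^ p * A ^ (p - 1 + p / N) * G := by
        gcongr; linarith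

/-- Sobolev inequalities in `W^{1,p}_0`, `p ≤ N`, with an exponent `r > p` that can be chosen at
least as large as a given `q ≤ p*`. -/
theorem exists_sobolev_exponent (N : ℕ) (hN : 1 ≤ N) {p q : ℝ} (hp : 1 ≤ p) (hpN : p ≤ N)
    (hq : (q : EReal) ≤ critExp N p) : ∃ (r p' : ℝ) (r' : ENNReal) (S : NNReal), p < r ∧ q ≤ r ∧
      ENNReal.ofReal r ≤ r' ∧ 1 ≤ p' ∧ p' ≤ p ∧ ∀ φ : RN N → ℝ, ContDiff ℝ ∞ φ → HasCompactSupport φ →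
      eLpNorm φ r' volume ≤
        S * eLpNorm (fderiv ℝ φ) (ENNReal.ofReal p') volume := by
  have hN0 : (0 : ℝ) < N := by exact_mod_cast hN
  have hfin : Module.finrank ℝ (RN N) = N := by simp
  have gns : ∀ r p' : ℝ, 1 ≤ p' → 0 < r → r⁻¹ = p'⁻¹ - (N : ℝ)⁻¹ → ∃ S : NNReal,
      ∀ φ : RN N → ℝ, ContDiff ℝ ∞ φ → HasCompactSupport φ →
      eLpNorm φ (ENNReal.ofReal r) volume ≤
        S * eLpNorm (fderiv ℝ φ) (ENNReal.ofReal p') volume := by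
    intro r p' hp' hr h
    refine ⟨eLpNormLESNormFDerivOfEqInnerConst (volume : Measure (RN N)) p'.toNNReal,
      fun φ hφ hc => ?_⟩
    refine eLpNorm_le_eLpNorm_fderiv_of_eq_inner volume (hφ.of_le (by simp)) hc
      (p := p'.toNNReal) (p' := r.toNNReal) (by simpa using hp') (by omega) ?_
    rw [Real.coe_toNNReal _ hr.le, hfin, NNReal.coe_inv, Real.coe_toNNReal _ (by linarith), h]
  rcases hpN.lt_or_eq with hlt | heq
  · have hd : 0 < N - p := sub_pos.2 hlt
    rw [critExp, if_pos hlt, EReal.coe_le_coe_iff] at hq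
    obtain ⟨S, hS⟩ := gns (N * p / (N - p)) p hp (by positivity) (by field_simp)
    refine ⟨N * p / (N - p), p, _, S, ?_, hq, le_rfl, hp, le_rfl, hS⟩
    rw [lt_div_iff₀ hd]; nlinarith
  -- Here p = N. In dimension one the L^∞ bound serves; otherwise p' = Nr/(N+r) < N has Sobolev
  -- conjugate r, and r ≥ N + 2 ensures both r > p and p' ≥ 1.
  · rcases hN.eq_or_lt with rfl | hN2
    · refine ⟨max q 2, 1, ⊤, 1, ?_, le_max_left _ _, le_top, le_rfl, hp, fun φ hφ hc => ?_⟩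
      · rw [heq, Nat.cast_one]
        exact lt_max_of_lt_right one_lt_two
      · rw [ENNReal.coe_one, one_mul]
        exact eLpNorm_top_le_of_dim_one hφ hc
    · have hN2' : (2 : ℝ) ≤ N := by exact_mod_cast hN2
      set r : ℝ := max q (N + 2) with hr
      have hr1 : (N : ℝ) + 2 ≤ r := le_max_right _ _
      have hr0 : 0 < r := by linarith
      have hp'1 : 1 ≤ N * r / (N + r) := by
        rw [le_div_iff₀ (by positivity)]; nlinarith
      obtain ⟨S, hS⟩ := gns r (N * r / (N + r)) hp'1 hr0 (by field_simp; ring)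
      refine ⟨r, N * r / (N + r), _, S, by linarith, le_max_left _ _, le_rfl, hp'1, ?_, hS⟩
      rw [heq, div_le_iff₀ (by positivity)]; nlinarith

/-- Used only for qualitative boundedness, so the constant may depend on Ω: Hölder on a set of
finite measure passes from r' to r and from p' to p. -/
theorem exists_rpow_excess_le (hN : 1 ≤ N) (hΩ : volume Ω < ⊤) {q : ℝ} (hp : 1 ≤ p)
    (hpN : p ≤ N) (hq : (q : EReal) ≤ critExp N p) : ∃ (r S : ℝ), p < r ∧ q ≤ r ∧ 0 < S ∧
    ∀ (u : RN N → ℝ) (Du : RN N → RN N), MemW0 Ω p u Du →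
      MemLp u (ENNReal.ofReal r) (volume.restrict Ω) ∧ ∀ k, 0 < k →
        (∫ x in Ω, max (|u x| - k) 0 ^ r) ^ (p / r) ≤
          S * levelEnergy (volume.restrict Ω) p u Du k := by
  obtain ⟨r, p', r', S, hpr, hqr, hrr', hp', hp'p, hS⟩ := exists_sobolev_exponent N hN hp hpN hq
  have : IsFiniteMeasure (volume.restrict Ω) := ⟨by simpa using hΩ⟩
  have hp0 : 0 < p := by linarith
  have hr0 : 0 < r := by linarith
  set m := volume.restrict Ω with hm
  set a : ℝ := 1 / (ENNReal.ofReal r).toReal - 1 / r'.toReal with ha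
  set b : ℝ := 1 / (ENNReal.ofReal p').toReal - 1 / (ENNReal.ofReal p).toReal with hb
  have ha0 : 0 ≤ a := by
    rw [ha, sub_nonneg]
    rcases eq_or_ne r' ⊤ with rfl | hr'
    · simp
    · refine one_div_le_one_div_of_le ?_ (ENNReal.toReal_mono hr' hrr')
      rwa [ENNReal.toReal_ofReal hr0.le]
  have hb0 : 0 ≤ b := by
    rw [hb, ENNReal.toReal_ofReal (by linarith), ENNReal.toReal_ofReal (by linarith)]
    exact sub_nonneg.2 (one_div_le_one_div_of_le (by linarith) hp'p)
  set T : ENNReal := S * m Set.univ ^ b * m Set.univ ^ a with hT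
  have hTtop : T ≠ ⊤ := ENNReal.mul_ne_top (ENNReal.mul_ne_top ENNReal.coe_ne_top
    (ENNReal.rpow_ne_top_of_nonneg hb0 (measure_ne_top _ _)))
    (ENNReal.rpow_ne_top_of_nonneg ha0 (measure_ne_top _ _))
  have main : ∀ (w : RN N → ℝ) (Dw : RN N → RN N), MemW0 Ω p w Dw →
      eLpNorm w (ENNReal.ofReal r) m ≤ T * eLpNorm Dw (ENNReal.ofReal p) m := by
    intro w Dw hw
    have h1 := eLpNorm_le_eLpNorm_mul_rpow_measure_univ hrr' hw.memLp.1
    have h2 := hw.eLpNorm_le_of_forall_test hp hΩ hp' hp'p hS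
    have h3 := eLpNorm_le_eLpNorm_mul_rpow_measure_univ (ENNReal.ofReal_le_ofReal hp'p)
      hw.memLp_grad.1
    calc _ ≤ _ := h1
      _ ≤ S * (eLpNorm Dw (ENNReal.ofReal p) m * m Set.univ ^ b) * m Set.univ ^ a := by
        gcongr
        exact h2.trans (by gcongr)
      _ = _ := by rw [hT]; ring
  refine ⟨r, (T.toReal + 1) ^ p, hpr, hqr, by positivity, fun u Du h => ⟨⟨h.memLp.1,
    (main u Du h).trans_lt (ENNReal.mul_lt_top hTtop.lt_top h.memLp_grad.2)⟩, fun k hk => ?_⟩⟩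
  have hw := h.sub_trunc hp hk
  have h1 := main _ _ hw
  have hG := levelEnergy_nonneg (m := m) (p := p) (u := u) (Du := Du) k
  have hwr : MemLp (fun x => u x - trunc k (u x)) (ENNReal.ofReal r) m :=
    ⟨hw.memLp.1, h1.trans_lt (ENNReal.mul_lt_top hTtop.lt_top hw.memLp_grad.2)⟩
  rw [h.levelEnergy_rpow hp hk, MemLp.eLpNorm_eq_integral_rpow_norm (by simpa using hr0)
    ENNReal.ofReal_ne_top hwr, ENNReal.toReal_ofReal hr0.le, ← ENNReal.ofReal_toReal hTtop,
    ← ENNReal.ofReal_mul ENNReal.toReal_nonneg, ENNReal.ofReal_le_ofReal_iff (by positivity)] at h1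
  simp only [Real.norm_eq_abs, abs_sub_trunc hk.le] at h1
  set I := ∫ x, max (|u x| - k) 0 ^ r ∂m
  have hI : 0 ≤ I := integral_nonneg fun x => Real.rpow_nonneg (le_max_right _ _) _
  set G := levelEnergy m p u Du k
  calc I ^ (p / r) = (I ^ r⁻¹) ^ p := by rw [← Real.rpow_mul hI]; congr 1; ring
    _ ≤ (T.toReal * G ^ (1 / p)) ^ p := by gcongr
    _ = T.toReal ^ p * G := by
      rw [Real.mul_rpow ENNReal.toReal_nonneg (by positivity), ← Real.rpow_mul hG,
        one_div_mul_cancel hp0.ne', Real.rpow_one]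
    _ ≤ (T.toReal + 1) ^ p * G := by gcongr; linarith

end

/-! ### Energy comparison with truncations. -/

section ExtIntegral

variable {α : Type*} [MeasurableSpace α] {m : Measure α}

theorem extIntegral_eq_integral {g : α → ℝ} (hg : Integrable g m) :
    extIntegral m g = ((∫ x, g x ∂m : ℝ) : EReal) := by
  have h1 : ∫⁻ x, ENNReal.ofReal (g x) ∂m ≠ ⊤ := hg.lintegral_lt_top.ne
  have h2 : ∫⁻ x, ENNReal.ofReal (-g x) ∂m ≠ ⊤ := hg.neg.lintegral_lt_top.ne
  rw [extIntegral, integral_eq_lintegral_pos_part_sub_lintegral_neg_part hg, EReal.coe_sub,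
    EReal.coe_ennreal_toReal h1, EReal.coe_ennreal_toReal h2]

/-- The negative part of h - g is at most g⁺, hence has finite integral. So the case ⊤ - ⊤, which
`EReal` evaluates to ⊥, cannot occur, and the positive part is finite too. -/
theorem integrable_of_extIntegral_lt_top {h g : α → ℝ} (hh : ∀ x, 0 ≤ h x)
    (hm : AEStronglyMeasurable h m) (hg : Integrable g m)
    (hlt : extIntegral m (fun x => h x - g x) < ⊤) : Integrable h m := by
  have h2 : ∫⁻ x, ENNReal.ofReal (-(h x - g x)) ∂m < ⊤ :=
    (lintegral_mono fun x => ENNReal.ofReal_le_ofReal (by linarith [hh x])).trans_lt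
      hg.lintegral_lt_top
  have h1 : ∫⁻ x, ENNReal.ofReal (h x - g x) ∂m < ⊤ := by
    by_contra htop
    rw [not_lt, top_le_iff] at htop
    rw [extIntegral, htop, ← ENNReal.ofReal_toReal h2.ne] at hlt
    simp [EReal.coe_ennreal_ofReal] at hlt
  have hi : Integrable (fun x => h x - g x) m := by
    refine ⟨hm.sub hg.1, ?_⟩
    rw [hasFiniteIntegral_iff_enorm]
    calc ∫⁻ x, ‖h x - g x‖ₑ ∂m
        ≤ ∫⁻ x, (ENNReal.ofReal (h x - g x) + ENNReal.ofReal (-(h x - g x))) ∂m := by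
          refine lintegral_mono fun x => ?_
          rw [Real.enorm_eq_ofReal_abs]
          rcases abs_choice (h x - g x) with e | e <;> rw [e]
          · exact le_self_add
          · exact le_add_self
      _ = _ := lintegral_add_left' ((hm.sub hg.1).aemeasurable.ennreal_ofReal) _
      _ < ⊤ := ENNReal.add_lt_top.2 ⟨h1, h2⟩
  refine (hi.add hg).congr (ae_of_all _ fun x => ?_)
  simp

end ExtIntegral

section

variable {N : ℕ} {Ω : Set (RN N)} {p c : ℝ} {H : RN N → ℝ} {f : RN N → ℝ → ℝ} {u : RN N → ℝ}
  {Du : RN N → RN N}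

theorem Standing.isFiniteMeasure (hst : Standing Ω p c H f) :
    IsFiniteMeasure (volume.restrict Ω) :=
  ⟨by simpa using hst.finite_measure⟩

theorem Standing.nonneg (hst : Standing Ω p c H f) (z : RN N) : 0 ≤ H z :=
  (mul_nonneg hst.c_pos.le (Real.rpow_nonneg (norm_nonneg z) p)).trans (hst.coercive z)

theorem Standing.continuous (hst : Standing Ω p c H f) : Continuous H :=
  hst.convex.locallyLipschitz.continuous

/-- f(x,u) T_k u is f(x,u) u times the ratio T_k u / u of modulus at most 1. This also yields
measurability without considering f(x,u) alone. -/
theorem MemV.trunc (hp : 1 ≤ p) (h : MemV Ω p f u u Du) {k : ℝ} (hk : 0 < k) :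
    MemV Ω p f u (fun x => trunc k (u x)) ({x | |u x| ≤ k}.indicator Du) := by
  refine ⟨h.1.trunc hp hk, ?_⟩
  have hm : AEStronglyMeasurable (fun x => _root_.trunc k (u x) / u x) (volume.restrict Ω) :=
    (((continuous_trunc k).measurable.comp_aemeasurable h.1.memLp.1.aemeasurable).div
      h.1.memLp.1.aemeasurable).aestronglyMeasurable
  have heq : (fun x => f x (u x) * _root_.trunc k (u x))
      = fun x => (f x (u x) * u x) * (_root_.trunc k (u x) / u x) := by
    ext x
    rcases eq_or_ne (u x) 0 with h0 | h0
    · simp [h0, trunc_of_abs_le (k := k) (t := 0) (by simpa using hk.le)]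
    · field_simp
  refine h.2.mono (heq ▸ h.2.1.mul hm) (ae_of_all _ fun x => ?_)
  rw [norm_mul, norm_mul]
  exact mul_le_mul_of_nonneg_left (abs_trunc_le_abs hk.le) (norm_nonneg _)

/-- Minimality against v = 0 gives J_u(u) ≤ H(0)|Ω| < ∞. -/
theorem IsEnergyCritical.integrable_comp_grad (hst : Standing Ω p c H f)
    (h : IsEnergyCritical Ω p H f u Du) : Integrable (fun x => H (Du x)) (volume.restrict Ω) := by
  have := hst.isFiniteMeasure
  refine integrable_of_extIntegral_lt_top (fun x => hst.nonneg _)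
    (hst.continuous.comp_aestronglyMeasurable h.mem.1.memLp_grad.1) h.mem.2 ?_
  refine (h.minimal (fun _ => 0) (fun _ => 0) ⟨MemW0.zero, by simp⟩).trans_lt ?_
  simp only [linearizedJ, mul_zero, sub_zero]
  rw [extIntegral_eq_integral (integrable_const _)]
  exact EReal.coe_lt_top _

/-- Comparison of an energy critical point with its truncations. -/
theorem IsEnergyCritical.levelEnergy_le (hst : Standing Ω p c H f)
    (h : IsEnergyCritical Ω p H f u Du) {k : ℝ} (hk : 0 < k) :
    c * levelEnergy (volume.restrict Ω) p u Du k ≤ H 0 * levelMeas (volume.restrict Ω) u k +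
      ∫ x in Ω, f x (u x) * (u x - trunc k (u x)) := by
  have := hst.isFiniteMeasure
  have hp := hst.one_le
  set m := volume.restrict Ω with hm
  have hu := h.mem.1
  have hT := h.mem.trunc hp hk
  have hH := h.integrable_comp_grad hst
  have hs : NullMeasurableSet {x | k < |u x|} m := nullMeasurableSet_level hu.memLp.1 k
  -- The truncation has zero gradient where |u| > k: it trades H(Du) for H(0) there and changes
  -- nothing elsewhere.
  have hcomp : ∀ x, H ({x | |u x| ≤ k}.indicator Du x)
      = H (Du x) - {x | k < |u x|}.indicator (fun x => H (Du x)) x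
        + H 0 * {x | k < |u x|}.indicator (fun _ => (1 : ℝ)) x := fun x => by
    by_cases hx : k < |u x|
    · simp [hx, not_le.2 hx]
    · simp [hx, not_lt.1 hx]
  have hi1 : Integrable ({x | k < |u x|}.indicator (fun x => H (Du x))) m := hH.indicator₀ hs
  have hi2 : Integrable ({x | k < |u x|}.indicator (fun _ => (1 : ℝ))) m :=
    (integrable_const 1).indicator₀ hs
  have hHT : Integrable (fun x => H ({x | |u x| ≤ k}.indicator Du x)) m := by
    simp only [hcomp]
    exact (hH.sub hi1).add (hi2.const_mul _)
  have hmin := h.minimal _ _ hT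
  have hJ : Integrable (fun x => H (Du x) - f x (u x) * u x) m := hH.sub h.mem.2
  have hJT : Integrable (fun x => H ({x | |u x| ≤ k}.indicator Du x)
      - f x (u x) * trunc k (u x)) m := hHT.sub hT.2
  rw [linearizedJ, linearizedJ, extIntegral_eq_integral hJ, extIntegral_eq_integral hJT,
    EReal.coe_le_coe_iff, integral_sub hH h.mem.2, integral_sub hHT hT.2] at hmin
  have e1 : ∫ x, H ({x | |u x| ≤ k}.indicator Du x) ∂m
      = ∫ x, H (Du x) ∂m - ∫ x, {x | k < |u x|}.indicator (fun x => H (Du x)) x ∂m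
        + H 0 * levelMeas m u k := by
    have hsub : Integrable (fun x => H (Du x) - {x | k < |u x|}.indicator (fun x => H (Du x)) x) m :=
      hH.sub hi1
    simp only [hcomp]
    rw [integral_add hsub (hi2.const_mul _), integral_sub hH hi1, integral_const_mul,
      integral_indicator_one_level hu.memLp.1]
  have e2 : ∫ x, f x (u x) * (u x - trunc k (u x)) ∂m
      = ∫ x, f x (u x) * u x ∂m - ∫ x, f x (u x) * trunc k (u x) ∂m := by
    rw [← integral_sub h.mem.2 hT.2]
    simp only [mul_sub, hm]
  have e3 : c * levelEnergy m p u Du k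
      ≤ ∫ x, {x | k < |u x|}.indicator (fun x => H (Du x)) x ∂m := by
    rw [levelEnergy, ← integral_const_mul]
    refine integral_mono_of_nonneg (ae_of_all _ fun x => ?_) hi1 (ae_of_all _ fun x => ?_)
    · exact mul_nonneg hst.c_pos.le (by positivity)
    · by_cases hx : k < |u x|
      · simpa [hx] using hst.coercive (Du x)
      · simp [hx, Real.zero_rpow (by linarith : p ≠ 0)]
  linarith

/-- Under the one-sided growth condition, the energy above a level is controlled by `u`. -/
theorem IsEnergyCritical.levelEnergy_le_of_growth (hst : Standing Ω p c H f)
    (h : IsEnergyCritical Ω p H f u Du) {μ θ q : ℝ} (hG : OneSidedGrowth Ω f μ θ q)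
    {k : ℝ} (hk : 0 < k) {g : RN N → ℝ} (hg : Integrable g (volume.restrict Ω))
    (hle : ∀ᵐ x ∂(volume.restrict Ω),
      μ * (|u x| + θ) ^ (q - 1) * max (|u x| - k) 0 ≤ g x) :
    c * levelEnergy (volume.restrict Ω) p u Du k ≤
      H 0 * levelMeas (volume.restrict Ω) u k + ∫ x in Ω, g x := by
  refine (h.levelEnergy_le hst hk).trans (add_le_add le_rfl ?_)
  have hi : Integrable (fun x => f x (u x) * (u x - trunc k (u x))) (volume.restrict Ω) := by
    simp only [mul_sub]
    exact h.mem.2.sub (h.mem.trunc hst.one_le hk).2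
  refine integral_mono_ae hi hg ?_
  filter_upwards [hG, hle] with x hx hx'
  refine le_trans ?_ hx'
  rw [sub_trunc hk.le, ← mul_assoc, mul_comm (f x (u x))]
  exact mul_le_mul_of_nonneg_right (hx _) (le_max_right _ _)

/-- Normalises a level inequality to the form φ^γ ≤ K A required by the extinction argument. -/
theorem Real.rpow_div_le_of_rpow_le {x y a b B : ℝ} (hx : 0 ≤ x) (hy : 0 ≤ y) (hB : 0 ≤ B)
    (hb : 0 < b) (h : x ^ a ≤ B * y ^ b) : x ^ (a / b) ≤ B ^ (1 / b) * y := by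
  calc x ^ (a / b) = (x ^ a) ^ (1 / b) := by rw [← Real.rpow_mul hx]; congr 1; ring
    _ ≤ (B * y ^ b) ^ (1 / b) := by gcongr
    _ = B ^ (1 / b) * y := by
      rw [Real.mul_rpow hB (by positivity), ← Real.rpow_mul hy, mul_one_div_cancel hb.ne',
        Real.rpow_one]

theorem Real.rpow_sub_one_le_of_rpow_le_mul {x p B : ℝ} (hx : 0 < x) (h : x ^ p ≤ B * x) :
    x ^ (p - 1) ≤ B := by
  rw [Real.rpow_sub_one hx.ne', div_le_iff₀ hx]
  exact h

end

/-! ### Boundedness from level inequalities. -/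

section Measure

variable {α : Type*} [MeasurableSpace α] {m : Measure α} [IsFiniteMeasure m] {u : α → ℝ}

theorem memLp_top_of_excess_eq_zero (hu : Integrable u m) {k : ℝ} (h : excess m u k = 0) :
    MemLp u ⊤ m :=
  memLp_top_of_bound hu.1 k (ae_abs_le_of_excess_eq_zero hu h)

theorem memLp_max_sub {r : ℝ} (hr : 1 ≤ r) (hu : MemLp u (ENNReal.ofReal r) m) {k : ℝ}
    (hk : 0 ≤ k) : MemLp (fun x => max (|u x| - k) 0) (ENNReal.ofReal r) m := by
  refine hu.mono ((integrable_max_sub (hu.integrable (by simpa using hr)) k).1)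
    (ae_of_all _ fun x => ?_)
  rw [Real.norm_eq_abs, Real.norm_eq_abs, abs_of_nonneg (le_max_right _ _)]
  exact max_le (by linarith) (abs_nonneg _)

theorem MeasureTheory.MemLp.integrable_abs_rpow {β : Type*} [MeasurableSpace β] {ν : Measure β}
    {w : β → ℝ} {r : ℝ} (hr : 0 < r) (hw : MemLp w (ENNReal.ofReal r) ν) :
    Integrable (fun x => |w x| ^ r) ν := by
  have := hw.integrable_norm_rpow (by simpa using hr) ENNReal.ofReal_ne_top
  simpa [ENNReal.toReal_ofReal hr.le] using this

theorem integrable_max_sub_rpow {r : ℝ} (hr : 1 ≤ r) (hu : MemLp u (ENNReal.ofReal r) m) {k : ℝ}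
    (hk : 0 ≤ k) : Integrable (fun x => max (|u x| - k) 0 ^ r) m := by
  simpa [abs_of_nonneg (le_max_right _ (0 : ℝ))] using
    (memLp_max_sub hr hu hk).integrable_abs_rpow (by linarith)

theorem tendsto_integral_max_sub_rpow {r : ℝ} (hr : 1 ≤ r) (hu : MemLp u (ENNReal.ofReal r) m) :
    Tendsto (fun n : ℕ => ∫ x, max (|u x| - n) 0 ^ r ∂m) atTop (𝓝 0) := by
  have hi := hu.integrable_abs_rpow (by linarith)
  have := tendsto_integral_of_dominated_convergence (μ := m)
    (F := fun (n : ℕ) x => max (|u x| - n) 0 ^ r) (f := fun _ => 0) (fun x => |u x| ^ r)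
    (fun n => (integrable_max_sub_rpow hr hu n.cast_nonneg).1) hi
    (fun n => ae_of_all _ fun x => ?_) (ae_of_all _ fun x => ?_)
  · simpa using this
  · rw [Real.norm_eq_abs, abs_of_nonneg (by positivity)]
    gcongr
    exact max_le (by linarith [n.cast_nonneg (α := ℝ)]) (abs_nonneg _)
  · obtain ⟨n₀, hn₀⟩ := exists_nat_ge |u x|
    refine tendsto_const_nhds.congr' ?_
    filter_upwards [eventually_ge_atTop n₀] with n hn
    have : (n₀ : ℝ) ≤ n := by exact_mod_cast hn
    rw [max_eq_right (by linarith), Real.zero_rpow (by linarith)]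

theorem rpow_mul_max_sub_le {r k t : ℝ} (hr : 1 ≤ r) (hk : 0 ≤ k) :
    k ^ (r - 1) * max (|t| - k) 0 ≤ |t| ^ r := by
  rcases le_or_gt |t| k with h | h
  · rw [max_eq_right (by linarith), mul_zero]; positivity
  · have ht : 0 < |t| := by linarith
    rw [max_eq_left (by linarith)]
    calc k ^ (r - 1) * (|t| - k) ≤ |t| ^ (r - 1) * |t| := by gcongr; linarith
      _ = |t| ^ r := by rw [Real.rpow_sub_one ht.ne']; field_simp

theorem rpow_mul_excess_le {r k : ℝ} (hr : 1 ≤ r) (hu : MemLp u (ENNReal.ofReal r) m)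
    (hk : 0 ≤ k) : k ^ (r - 1) * excess m u k ≤ ∫ x, |u x| ^ r ∂m := by
  rw [excess, ← integral_const_mul]
  exact integral_mono ((integrable_max_sub (hu.integrable (by simpa using hr)) k).const_mul _)
    (hu.integrable_abs_rpow (by linarith)) fun x => rpow_mul_max_sub_le hr hk

/-- The integrands are dominated by |u|^r and vanish once n ≥ |u|. The resulting φ(n) = o(n^(1-r))
is the smallness that settles the critical case. -/
theorem tendsto_rpow_mul_excess {r : ℝ} (hr : 1 ≤ r) (hu : MemLp u (ENNReal.ofReal r) m) :
    Tendsto (fun n : ℕ => (n : ℝ) ^ (r - 1) * excess m u n) atTop (𝓝 0) := by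
  have hui : Integrable u m := hu.integrable (by simpa using hr)
  have hi := hu.integrable_abs_rpow (by linarith)
  have := tendsto_integral_of_dominated_convergence (μ := m)
    (F := fun (n : ℕ) x => (n : ℝ) ^ (r - 1) * max (|u x| - n) 0) (f := fun _ => 0)
    (fun x => |u x| ^ r)
    (fun n => ((integrable_max_sub hui n).const_mul _).1) hi
    (fun n => ae_of_all _ fun x => ?_) (ae_of_all _ fun x => ?_)
  · simpa [integral_const_mul, excess] using this
  · rw [Real.norm_eq_abs, abs_of_nonneg (by positivity)]
    exact rpow_mul_max_sub_le hr n.cast_nonneg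
  · obtain ⟨n₀, hn₀⟩ := exists_nat_ge |u x|
    refine tendsto_const_nhds.congr' ?_
    filter_upwards [eventually_ge_atTop n₀] with n hn
    have : (n₀ : ℝ) ≤ n := by exact_mod_cast hn
    rw [max_eq_right (by linarith), mul_zero]

/-- A function is bounded if its excess over a level decays superlinearly in the measure of the
superlevel sets. -/
theorem memLp_top_of_excess_rpow_le (hu : Integrable u m) {p D B : ℝ} (hp : 0 ≤ p) (hpD : p < D)
    (hB : 0 ≤ B) (h : ∀ k, 0 < k → excess m u k ^ p ≤ B * levelMeas m u k ^ D) :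
    MemLp u ⊤ m := by
  have hD : 0 < D := by linarith
  have hγ : p / D < 1 := by rwa [div_lt_one hD]
  refine memLp_top_of_excess_eq_zero hu
    (eq_zero_of_rpow_le_decrease (φ := excess m u) (A := levelMeas m u) (k := 1) (γ₁ := 0)
      (γ₂ := p / D) (K₁ := 0) (K₂ := B ^ (1 / D)) excess_nonneg levelMeas_nonneg
      (fun a b _ hab => excess_add_le hu hab) le_rfl one_pos (by positivity) hγ le_rfl
      (by positivity) (fun k hk _ _ => Or.inr ?_) le_rfl)
  exact Real.rpow_div_le_of_rpow_le (excess_nonneg k) (levelMeas_nonneg k) hB hD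
    (h k (by linarith))

/-- Boundedness from the energy estimate with the critical exponent `r`: the excess over `k` is
small compared to `k ^ (1 - r)`, hence it vanishes before the level `2 k`. -/
theorem memLp_top_of_critical {p r Q k₀ : ℝ} (hp : 1 ≤ p) (hpr : p < r)
    (hu : MemLp u (ENNReal.ofReal r) m) (hQ : 0 ≤ Q)
    (h : ∀ k, 0 < k → k₀ ≤ k → (∫ x, max (|u x| - k) 0 ^ r ∂m) ^ (p / r) ≤
      Q * (levelMeas m u k + k ^ (r - 1) * excess m u k)) : MemLp u ⊤ m := by
  have hr : 1 < r := by linarith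
  have hr0 : 0 < r := by linarith
  have hui : Integrable u m := hu.integrable (by simpa using hr.le)
  set D := p - p / r with hDdef
  have hD : 0 < D := by
    rw [hDdef, sub_pos, div_lt_iff₀ hr0]; nlinarith
  have hpr1 : p / r < 1 := by rwa [div_lt_one hr0]
  set β₁ := 1 - p / (D + 1) with hβ₁
  set β₂ := 1 - (p - 1) / D with hβ₂
  have hβ₁0 : 0 < β₁ := by
    rw [hβ₁, sub_pos, div_lt_one (by linarith)]; linarith
  have hβ₂0 : 0 < β₂ := by
    rw [hβ₂, sub_pos, div_lt_one hD]; linarith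
  -- Scaling identity: it turns the second extinction length, of order k^((r-1)/D) φ(k)^β₂, into k
  -- (k^(r-1) φ(k))^β₂ = k·o(1).
  have hexp : (r - 1) / D = 1 + (r - 1) * β₂ := by
    have hp0 : p ≠ 0 := by linarith
    have hr1 : r - 1 ≠ 0 := by linarith
    have hDe : D = p * (r - 1) / r := by rw [hDdef]; field_simp
    rw [hβ₂, hDe]; field_simp; ring
  have hhold : ∀ k, 0 < k → k₀ ≤ k → excess m u k ^ p ≤
      Q * (levelMeas m u k + k ^ (r - 1) * excess m u k) * levelMeas m u k ^ D := by
    intro k hk hk₀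
    have h1 := integral_le_rpow_mul_measureReal (m := m) (w := fun x => max (|u x| - k) 0)
      (fun _ => le_max_right _ _) (nullMeasurableSet_level hu.1 k)
      (fun x hx => max_eq_right (by
        have : ¬ k < |u x| := hx
        linarith)) hr.le
      (memLp_max_sub hr.le hu hk.le)
    set I := ∫ x, max (|u x| - k) 0 ^ r ∂m with hI
    have hI0 : 0 ≤ I := integral_nonneg fun x => Real.rpow_nonneg (le_max_right _ _) _
    have hA := levelMeas_nonneg (m := m) (u := u) k
    calc excess m u k ^ p ≤ (I ^ (1 / r) * levelMeas m u k ^ (1 - 1 / r)) ^ p :=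
          Real.rpow_le_rpow (excess_nonneg k) h1 (by linarith)
      _ = I ^ (p / r) * levelMeas m u k ^ D := by
          rw [Real.mul_rpow (by positivity) (by positivity), ← Real.rpow_mul hI0,
            ← Real.rpow_mul hA, hDdef]
          congr 2 <;> ring
      _ ≤ _ := by
          gcongr
          exact h k hk hk₀
  set K₁ := (2 * Q) ^ (1 / (D + 1)) with hK₁
  set b := (2 * Q * 2 ^ (r - 1)) ^ (1 / D) with hb
  have hd₁ : 0 < (2 : ℝ) ^ β₁ - 1 := by linarith [Real.one_lt_rpow (one_lt_two) hβ₁0]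
  have hd₂ : 0 < (2 : ℝ) ^ β₂ - 1 := by linarith [Real.one_lt_rpow (one_lt_two) hβ₂0]
  have hlim := tendsto_rpow_mul_excess hr.le hu
  have hlim₁ : Tendsto (fun n : ℕ => K₁ * ((n : ℝ) ^ (r - 1) * excess m u n) ^ β₁
      / (2 ^ β₁ - 1)) atTop (𝓝 0) := by
    have := ((hlim.rpow_const (p := β₁) (Or.inr hβ₁0.le)).const_mul K₁).div_const (2 ^ β₁ - 1)
    simpa [Real.zero_rpow hβ₁0.ne'] using this
  have hlim₂ : Tendsto (fun n : ℕ => b * ((n : ℝ) ^ (r - 1) * excess m u n) ^ β₂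
      / (2 ^ β₂ - 1)) atTop (𝓝 0) := by
    have := ((hlim.rpow_const (p := β₂) (Or.inr hβ₂0.le)).const_mul b).div_const (2 ^ β₂ - 1)
    simpa [Real.zero_rpow hβ₂0.ne'] using this
  obtain ⟨n₀, hn₀⟩ := exists_nat_ge k₀
  obtain ⟨n, hn, hn1, hnk, hnl⟩ := ((hlim₁.eventually (eventually_le_nhds one_half_pos)).and
    ((hlim₂.eventually (eventually_le_nhds one_half_pos)).and
      ((eventually_ge_atTop n₀).and (eventually_ge_atTop 1)))).exists
  set k : ℝ := (n : ℝ) with hk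
  have hk1 : 1 ≤ k := by rw [hk]; exact_mod_cast hnl
  have hk0 : 0 < k := by linarith
  have hkk₀ : k₀ ≤ k := hn₀.trans (by rw [hk]; exact_mod_cast hnk)
  have hφ := excess_nonneg (m := m) (u := u) k
  refine memLp_top_of_excess_eq_zero (k := 2 * k) hui
    (eq_zero_of_rpow_le_decrease (φ := excess m u) (A := levelMeas m u) (k := k)
      (γ₁ := p / (D + 1)) (γ₂ := (p - 1) / D) (K₁ := K₁) (K₂ := b * k ^ ((r - 1) / D))
      excess_nonneg levelMeas_nonneg
      (fun a b _ hab => excess_add_le hui hab) (by positivity) (by linarith)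
      (div_nonneg (by linarith) hD.le) (by linarith) (by positivity)
      (by positivity) (fun h' hkh hhL hpos => ?_) ?_)
  · have hh0 : 0 < h' := by linarith
    have h1 := hhold h' hh0 (hkk₀.trans hkh)
    have hA := levelMeas_nonneg (m := m) (u := u) h'
    set A := levelMeas m u h'
    -- Whichever term dominates decides the alternative: φ^p ≤ 2Q A^(D+1), or, after dividing by φ
    -- and using h' ≤ 2k, φ^(p-1) ≤ const·k^(r-1) A^D. Both exponent ratios are below 1 because p <
    -- r.
    rcases le_total (h' ^ (r - 1) * excess m u h') A with hle | hle
    · refine Or.inl (Real.rpow_div_le_of_rpow_le hpos.le hA (by positivity) (by linarith) ?_)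
      calc _ ≤ _ := h1
        _ ≤ Q * (A + A) * A ^ D := by gcongr
        _ = 2 * Q * A ^ (D + 1) := by
          rw [Real.rpow_add_of_nonneg hA hD.le zero_le_one, Real.rpow_one]; ring
    · right
      have h2 : excess m u h' ^ (p - 1) ≤ 2 * Q * 2 ^ (r - 1) * k ^ (r - 1) * A ^ D := by
        refine Real.rpow_sub_one_le_of_rpow_le_mul hpos ?_
        calc _ ≤ _ := h1
          _ ≤ Q * (h' ^ (r - 1) * excess m u h' + h' ^ (r - 1) * excess m u h') * A ^ D := by
            gcongr
          _ = 2 * Q * h' ^ (r - 1) * A ^ D * excess m u h' := by ring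
          _ ≤ 2 * Q * (2 * k) ^ (r - 1) * A ^ D * excess m u h' := by gcongr
          _ = _ := by rw [Real.mul_rpow zero_le_two hk0.le]; ring
      have h3 := Real.rpow_div_le_of_rpow_le hpos.le hA (by positivity) hD h2
      rwa [Real.mul_rpow (by positivity) (by positivity), ← Real.rpow_mul hk0.le,
        mul_one_div] at h3
  · have e1 : K₁ * excess m u k ^ β₁ / (2 ^ β₁ - 1) ≤ 1 / 2 := by
      refine le_trans ?_ hn
      gcongr
      exact le_mul_of_one_le_left hφ (Real.one_le_rpow hk1 (by linarith))
    have e2 : b * k ^ ((r - 1) / D) * excess m u k ^ β₂ / (2 ^ β₂ - 1)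
        = k * (b * (k ^ (r - 1) * excess m u k) ^ β₂ / (2 ^ β₂ - 1)) := by
      rw [hexp, Real.rpow_add hk0, Real.rpow_one, Real.mul_rpow (by positivity) hφ,
        ← Real.rpow_mul hk0.le]
      ring
    rw [e2]
    nlinarith

end Measure

/-! ### Boundedness of energy critical points. -/

section

variable {N : ℕ} {Ω : Set (RN N)} {p c : ℝ} {H : RN N → ℝ} {f : RN N → ℝ → ℝ} {u : RN N → ℝ}
  {Du : RN N → RN N}

theorem MemW0.levelEnergy_le (hp : 1 ≤ p) (h : MemW0 Ω p u Du) (k : ℝ) :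
    levelEnergy (volume.restrict Ω) p u Du k ≤ ∫ x in Ω, ‖Du x‖ ^ p := by
  have hp0 : 0 < p := by linarith
  have hi : Integrable (fun x => ‖Du x‖ ^ p) (volume.restrict Ω) := by
    have := h.memLp_grad.integrable_norm_rpow (by simpa using hp0) ENNReal.ofReal_ne_top
    simpa [ENNReal.toReal_ofReal hp0.le] using this
  refine integral_mono_of_nonneg (ae_of_all _ fun x => by positivity) hi (ae_of_all _ fun x => ?_)
  exact Real.rpow_le_rpow (norm_nonneg _) (norm_indicator_le_norm_self _ _) hp0.le

/-- Functions of `W^{1,p}_0(Ω)` are bounded if `p > N`. -/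
theorem MemW0.memLp_top_of_dim_lt (hN : 1 ≤ N) (hp : 1 ≤ p) (hNp : (N : ℝ) < p)
    (hΩ : volume Ω < ⊤) (h : MemW0 Ω p u Du) : MemLp u ⊤ (volume.restrict Ω) := by
  have : IsFiniteMeasure (volume.restrict Ω) := ⟨by simpa using hΩ⟩
  have hN0 : (0 : ℝ) < N := by exact_mod_cast hN
  obtain ⟨C, hC, hle⟩ := exists_excess_le N hN
  -- This makes p - 1 + p/N > p, the superlinear decay required.
  have h1 : 1 < p / N := by rwa [one_lt_div hN0]
  refine memLp_top_of_excess_rpow_le (h.integrable hp) (p := p) (D := p - 1 + p / N)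
    (B := C ^ p * ∫ x in Ω, ‖Du x‖ ^ p) (by linarith) (by linarith)
    (mul_nonneg (by positivity) (integral_nonneg fun _ => by positivity)) fun k hk => ?_
  refine (hle Ω p u Du k hΩ hp h hk).trans ?_
  rw [mul_right_comm]
  have := levelMeas_nonneg (m := volume.restrict Ω) (u := u) k
  gcongr
  exact h.levelEnergy_le hp k

/-- Where |t| > k the base |t| + θ is at least 1, so q may be raised to r; with w = |t| - k the base
is at most 4 max(w, k), and the two cases give the two terms. -/
theorem growth_mul_le {μ θ q r k t : ℝ} (hμ : 0 ≤ μ) (hθ : 0 ≤ θ) (hqr : q ≤ r)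
    (hr : 1 < r) (hk : 1 ≤ k) (hθk : θ ≤ k) :
    μ * (|t| + θ) ^ (q - 1) * max (|t| - k) 0 ≤
      μ * 4 ^ (r - 1) * (max (|t| - k) 0 ^ r + k ^ (r - 1) * max (|t| - k) 0) := by
  rcases le_or_gt |t| k with h | h
  · rw [max_eq_right (by linarith), mul_zero]
    positivity
  set w := |t| - k with hw
  have hw0 : 0 < w := by linarith
  have ht : |t| = w + k := by linarith
  rw [max_eq_left hw0.le, mul_assoc, mul_assoc]
  refine mul_le_mul_of_nonneg_left ?_ hμ
  have hr1 : 0 ≤ r - 1 := by linarith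
  calc (|t| + θ) ^ (q - 1) * w ≤ (|t| + θ) ^ (r - 1) * w := by
        gcongr; linarith
    _ ≤ (4 * max w k) ^ (r - 1) * w := by
        gcongr
        linarith [le_max_left w k, le_max_right w k]
    _ = 4 ^ (r - 1) * (max w k ^ (r - 1) * w) := by
        rw [Real.mul_rpow (by norm_num) (by positivity)]; ring
    _ ≤ 4 ^ (r - 1) * ((w ^ (r - 1) + k ^ (r - 1)) * w) := by
        gcongr
        rcases le_total w k with h | h
        · rw [max_eq_right h]; linarith [Real.rpow_nonneg hw0.le (r - 1)]
        · rw [max_eq_left h]; linarith [Real.rpow_nonneg (by linarith : 0 ≤ k) (r - 1)]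
    _ = 4 ^ (r - 1) * (w ^ r + k ^ (r - 1) * w) := by
        rw [add_mul, ← Real.rpow_add_one hw0.ne', sub_add_cancel]

/-- Energy critical points are bounded under a growth condition of at most critical order. -/
theorem IsEnergyCritical.memLp_top_of_growth (hN : 1 ≤ N) (hst : Standing Ω p c H f)
    (hpN : p ≤ N) {μ θ q : ℝ} (hμ : 0 ≤ μ) (hθ : 0 ≤ θ)
    (hqc : (q : EReal) ≤ critExp N p) (hG : OneSidedGrowth Ω f μ θ q)
    (h : IsEnergyCritical Ω p H f u Du) : MemLp u ⊤ (volume.restrict Ω) := by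
  have := hst.isFiniteMeasure
  have hp := hst.one_le
  have hc := hst.c_pos
  obtain ⟨r, S, hpr, hqr, hS, hSob⟩ :=
    exists_rpow_excess_le hN hst.finite_measure hp hpN hqc
  obtain ⟨hur, hSob⟩ := hSob u Du h.mem.1
  set m := volume.restrict Ω
  have hr : 1 < r := by linarith
  have hr0 : 0 < r := by linarith
  have hui : Integrable u m := hur.integrable (by simpa using hr.le)
  set B := μ * 4 ^ (r - 1) with hB
  have hB0 : 0 ≤ B := by positivity
  have hH0 := hst.nonneg 0
  set I : ℝ → ℝ := fun k => ∫ x, max (|u x| - k) 0 ^ r ∂m with hI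
  have hI0 : ∀ k, 0 ≤ I k := fun k =>
    integral_nonneg fun x => Real.rpow_nonneg (le_max_right _ _) _
  have hexp : 0 < 1 - p / r := by rw [sub_pos, div_lt_one hr0]; exact hpr
  have hlim : Tendsto (fun n : ℕ => S / c * B * I n ^ (1 - p / r)) atTop (𝓝 0) := by
    have := ((tendsto_integral_max_sub_rpow hr.le hur).rpow_const (p := 1 - p / r)
      (Or.inr hexp.le)).const_mul (S / c * B)
    simpa [Real.zero_rpow hexp.ne'] using this
  -- Chosen for absorption: I(k) = I(k)^(1-p/r) I(k)^(p/r), and for k ≥ n the first factor makes the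
  -- growth term at most half of I(k)^(p/r).
  obtain ⟨n, hn⟩ := (hlim.eventually (eventually_le_nhds one_half_pos)).exists
  refine memLp_top_of_critical (p := p) (r := r) (Q := 2 * (S / c * (H 0 + B)))
    (k₀ := max (max 1 θ) n) hp hpr hur (by positivity) fun k hk hkk => ?_
  simp only [max_le_iff] at hkk
  obtain ⟨⟨hk1, hkθ⟩, hkn⟩ := hkk
  have hIk : I k ≤ I n :=
    integral_mono (integrable_max_sub_rpow hr.le hur hk.le)
      (integrable_max_sub_rpow hr.le hur n.cast_nonneg) fun x => by
        have : max (|u x| - k) 0 ≤ max (|u x| - n) 0 := max_le_max (by linarith) le_rfl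
        exact Real.rpow_le_rpow (le_max_right _ _) this hr0.le
  have hA := levelMeas_nonneg (m := m) (u := u) k
  have hφ := excess_nonneg (m := m) (u := u) k
  have hi1 := integrable_max_sub_rpow hr.le hur hk.le
  have hi2 := (integrable_max_sub hui k).const_mul (k ^ (r - 1))
  have hE := h.levelEnergy_le_of_growth hst hG hk ((hi1.add hi2).const_mul B)
    (ae_of_all _ fun x => growth_mul_le hμ hθ hqr hr hk1 hkθ)
  have hint : ∫ x, B * ((fun x => max (|u x| - k) 0 ^ r) + fun x =>
      k ^ (r - 1) * max (|u x| - k) 0) x ∂m = B * (I k + k ^ (r - 1) * excess m u k) := by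
    rw [integral_const_mul, integral_add' hi1 hi2, integral_const_mul]
    rfl
  rw [hint] at hE
  have hsplit : I k ^ (p / r) * I k ^ (1 - p / r) = I k := by
    rw [← Real.rpow_add_of_nonneg (hI0 k) (by positivity) hexp.le]; simp
  have habs : S / c * (B * I k) ≤ 1 / 2 * I k ^ (p / r) := by
    calc S / c * (B * I k) = S / c * B * I k ^ (1 - p / r) * I k ^ (p / r) := by
          nth_rewrite 1 [← hsplit]; ring
      _ ≤ S / c * B * I n ^ (1 - p / r) * I k ^ (p / r) := by
          have := hI0 k
          gcongr
      _ ≤ 1 / 2 * I k ^ (p / r) := by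
          have := hI0 k
          gcongr
  have h1 : I k ^ (p / r) ≤ S / c * (H 0 * levelMeas m u k
      + B * (I k + k ^ (r - 1) * excess m u k)) := by
    refine (hSob k hk).trans ?_
    rw [div_mul_eq_mul_div, le_div_iff₀ hc]
    calc _ = S * (c * levelEnergy m p u Du k) := by ring
      _ ≤ _ := by gcongr
  have hx : 0 ≤ k ^ (r - 1) * excess m u k := by positivity
  have hSc : 0 < S / c := by positivity
  have h2 : H 0 * levelMeas m u k + B * (k ^ (r - 1) * excess m u k)
      ≤ (H 0 + B) * (levelMeas m u k + k ^ (r - 1) * excess m u k) := by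
    nlinarith [mul_nonneg hH0 hx, mul_nonneg hB0 hA]
  change I k ^ (p / r) ≤ _
  nlinarith [mul_le_mul_of_nonneg_left h2 hSc.le]

theorem IsEnergyCritical.memLp_top (hN : 1 ≤ N) (hst : Standing Ω p c H f)
    (hG : p ≤ (N : ℝ) → ∃ μ θ q : ℝ, 0 ≤ μ ∧ 0 ≤ θ ∧ 1 ≤ q ∧ (q : EReal) ≤ critExp N p ∧
      OneSidedGrowth Ω f μ θ q)
    (h : IsEnergyCritical Ω p H f u Du) : MemLp u ⊤ (volume.restrict Ω) := by
  rcases le_or_gt p N with hpN | hpN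
  · obtain ⟨μ, θ, q, hμ, hθ, -, hqc, hG⟩ := hG hpN
    exact h.memLp_top_of_growth hN hst hpN hμ hθ hqc hG
  · exact h.mem.1.memLp_top_of_dim_lt hN hst.one_le hpN hst.finite_measure

/-! ### The quantitative estimate. -/

/-- For `(p, q)` subcritical, the denominator of the exponent in the estimate is positive. -/
theorem denominator_pos (hN : 1 ≤ N) {q : ℝ} (hp : 1 ≤ p) (hq : 1 ≤ q)
    (hqc : (q : EReal) < critExp N p) : 0 < p * q + (p - q) * (N : ℝ) := by
  have hN0 : (0 : ℝ) < N := by exact_mod_cast hN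
  rcases lt_or_ge p N with hlt | hle
  · rw [critExp, if_pos hlt, EReal.coe_lt_coe_iff, lt_div_iff₀ (sub_pos.2 hlt)] at hqc
    linarith
  · nlinarith [mul_nonneg (sub_nonneg.2 hle) (by linarith : 0 ≤ q)]

/-- The constant of the quantitative estimate, in terms of the constant `S` of the Sobolev
inequality in `W^{1,1}`. -/
noncomputable def boundConst (N : ℕ) (S p q : ℝ) : ℝ :=
  2 * (S ^ p * 4 ^ (q - 1) *
    (2 ^ (p / N / (p - 1 + p / N)) - 1) ^ (-(p - 1 + p / N))) ^ (N / (p * q + (p - q) * N))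

theorem two_rpow_sub_one_pos (hN : 1 ≤ N) (hp : 1 ≤ p) :
    0 < (2 : ℝ) ^ (p / N / (p - 1 + p / N)) - 1 := by
  have hN0 : (0 : ℝ) < N := by exact_mod_cast hN
  have : 0 < p / N := by positivity
  linarith [Real.one_lt_rpow one_lt_two (div_pos this (by linarith : 0 < p - 1 + p / N))]

theorem boundConst_pos (hN : 1 ≤ N) {S q : ℝ} (hS : 0 < S) (hp : 1 ≤ p) :
    0 < boundConst N S p q := by
  have := two_rpow_sub_one_pos hN hp
  unfold boundConst
  positivity

/-- S is fixed by N alone, all bases are positive, and the denominators do not vanish on the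
subcritical set. -/
theorem continuousOn_boundConst (hN : 1 ≤ N) {S : ℝ} (hS : 0 < S) :
    ContinuousOn (fun z : ℝ × ℝ => boundConst N S z.1 z.2) (subcritical N) := by
  have hN0 : (0 : ℝ) < N := by exact_mod_cast hN
  intro z hz
  obtain ⟨hp, hq, hqc⟩ := hz
  have h1 := two_rpow_sub_one_pos hN hp
  have h2 : 0 < z.1 / N := by positivity
  have h3 : z.1 - 1 + z.1 / N ≠ 0 := by linarith
  have h4 := denominator_pos hN hp hq hqc
  refine ContinuousAt.continuousWithinAt ?_
  have hD : ContinuousAt (fun z : ℝ × ℝ => z.1 - 1 + z.1 / N) z := by fun_prop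
  have hδ : ContinuousAt (fun z : ℝ × ℝ => (2 : ℝ) ^ (z.1 / N / (z.1 - 1 + z.1 / N)) - 1) z :=
    (ContinuousAt.rpow continuousAt_const (ContinuousAt.div (by fun_prop) hD h3)
      (Or.inl two_ne_zero)).sub continuousAt_const
  have hS' : ContinuousAt (fun z : ℝ × ℝ => S ^ z.1) z :=
    ContinuousAt.rpow continuousAt_const continuousAt_fst (Or.inl hS.ne')
  have h4' : ContinuousAt (fun z : ℝ × ℝ => (4 : ℝ) ^ (z.2 - 1)) z :=
    ContinuousAt.rpow continuousAt_const (by fun_prop) (Or.inl four_ne_zero)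
  unfold boundConst
  refine continuousAt_const.mul (ContinuousAt.rpow
    ((hS'.mul h4').mul (hδ.rpow hD.neg (Or.inl h1.ne')))
    (ContinuousAt.div continuousAt_const (by fun_prop) h4.ne') (Or.inl ?_))
  positivity

/-- The algebra leading from the extinction estimate to the bound of the maximum. -/
theorem le_boundConst_mul (hN : 1 ≤ N) {S q t I x : ℝ} (hS : 0 < S) (hp : 1 ≤ p) (hx : 0 < x)
    (hI : 0 ≤ I) (ht : 0 ≤ t) (hpos : 0 < p * q + (p - q) * (N : ℝ))
    (h : x ≤ (S ^ p * t * (4 * x) ^ (q - 1)) ^ (1 / (p - 1 + p / N)) *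
      (x ^ (1 - q) * I) ^ (p / N / (p - 1 + p / N)) / (2 ^ (p / N / (p - 1 + p / N)) - 1)) :
    2 * x ≤ boundConst N S p q *
      (t ^ ((N : ℝ) / p) * I) ^ (p / (p * q + (p - q) * (N : ℝ))) := by
  have hN0 : (0 : ℝ) < N := by exact_mod_cast hN
  have hp0 : 0 < p := by linarith
  have hpN : 0 < p / N := by positivity
  have hδ := two_rpow_sub_one_pos hN hp
  unfold boundConst
  set D := p - 1 + p / N with hD
  set δ := (2 : ℝ) ^ (p / N / D) - 1 with hδdef
  have hD0 : 0 < D := by linarith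
  set P := p * q + (p - q) * (N : ℝ) with hP
  have h1 : x ^ D ≤ S ^ p * t * (4 * x) ^ (q - 1) * (x ^ (1 - q) * I) ^ (p / N) * δ ^ (-D) := by
    calc x ^ D ≤ _ := Real.rpow_le_rpow hx.le h hD0.le
      _ = _ := by
        rw [Real.div_rpow (by positivity) hδ.le, Real.mul_rpow (by positivity) (by positivity),
          ← Real.rpow_mul (by positivity), ← Real.rpow_mul (by positivity),
          one_div_mul_cancel hD0.ne', Real.rpow_one, div_mul_cancel₀ _ hD0.ne',
          Real.rpow_neg hδ.le, div_eq_mul_inv]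
  set Γ := S ^ p * 4 ^ (q - 1) * δ ^ (-D) with hΓ
  have hΓ0 : 0 < Γ := by positivity
  have hNp : (t ^ ((N : ℝ) / p)) ^ (p / N) = t := by
    rw [← Real.rpow_mul ht, div_mul_div_cancel₀ hp0.ne', div_self hN0.ne', Real.rpow_one]
  have h2 : x ^ (P / N) ≤ Γ * (t ^ ((N : ℝ) / p) * I) ^ (p / N) := by
    -- The net power of x: D from the left side, less q - 1 from the growth factor and (1-q)p/N from
    -- the bound of the excess.
    have e : P / N = D - (q - 1 + (1 - q) * (p / N)) := by
      rw [hP, hD]; field_simp; ring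
    rw [e, Real.rpow_sub hx, div_le_iff₀ (by positivity)]
    refine h1.trans (le_of_eq ?_)
    rw [Real.mul_rpow (by norm_num) hx.le, Real.mul_rpow (by positivity) hI,
      Real.mul_rpow (by positivity) hI, hNp, ← Real.rpow_mul hx.le, Real.rpow_add hx, hΓ]
    ring
  have h3 : x ≤ (Γ * (t ^ ((N : ℝ) / p) * I) ^ (p / N)) ^ ((N : ℝ) / P) := by
    calc x = (x ^ (P / N)) ^ ((N : ℝ) / P) := by
          rw [← Real.rpow_mul hx.le, div_mul_div_cancel₀ hN0.ne', div_self hpos.ne', Real.rpow_one]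
      _ ≤ _ := by gcongr
  rw [Real.mul_rpow hΓ0.le (by positivity), ← Real.rpow_mul (by positivity),
    div_mul_div_cancel₀ hN0.ne'] at h3
  rw [mul_assoc]
  linarith

/-- The quantitative estimate of the maximum of an energy critical point. -/
theorem IsEnergyCritical.eLpNorm_top_le (hN : 1 ≤ N) {S : ℝ} (hS : 0 < S)
    (hSob : ∀ (Ω : Set (RN N)) (p : ℝ) (u : RN N → ℝ) (Du : RN N → RN N) (k : ℝ), volume Ω < ⊤ →
      1 ≤ p → MemW0 Ω p u Du → 0 < k → excess (volume.restrict Ω) u k ^ p ≤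
        S ^ p * levelMeas (volume.restrict Ω) u k ^ (p - 1 + p / N) *
          levelEnergy (volume.restrict Ω) p u Du k)
    (hst : Standing Ω p c H f) (hH : H 0 = 0) {μ θ q : ℝ} (hμ : 0 ≤ μ) (hθ : 0 ≤ θ) (hq : 1 ≤ q)
    (hqc : (q : EReal) < critExp N p) (hG : OneSidedGrowth Ω f μ θ q)
    (h : IsEnergyCritical Ω p H f u Du) :
    Integrable (fun x => |u x| ^ q) (volume.restrict Ω) ∧
      eLpNorm u ⊤ (volume.restrict Ω) ≤ ENNReal.ofReal
        (max θ (boundConst N S p q * ((μ / c) ^ ((N : ℝ) / p) * ∫ x in Ω, |u x| ^ q) ^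
          (p / (p * q + (p - q) * (N : ℝ))))) := by
  have := hst.isFiniteMeasure
  have hp := hst.one_le
  have hc := hst.c_pos
  have hN0 : (0 : ℝ) < N := by exact_mod_cast hN
  have hpN : 0 < p / N := by positivity
  have htop := h.memLp_top hN hst fun _ => ⟨μ, θ, q, hμ, hθ, hq, hqc.le, hG⟩
  set m := volume.restrict Ω
  have huq : MemLp u (ENNReal.ofReal q) m := htop.mono_exponent le_top
  have hint := huq.integrable_abs_rpow (by linarith : 0 < q)
  refine ⟨hint, ?_⟩
  have hui : Integrable u m := huq.integrable (by simpa using hq)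
  set M := (eLpNorm u ⊤ m).toReal with hM
  have hMeq : eLpNorm u ⊤ m = ENNReal.ofReal M := (ENNReal.ofReal_toReal htop.2.ne).symm
  rw [hMeq]
  refine ENNReal.ofReal_le_ofReal ?_
  rcases le_or_gt M θ with hle | hlt
  · exact hle.trans (le_max_left _ _)
  refine le_max_of_le_right ?_
  have hM0 : 0 < M := by linarith
  have hae : ∀ᵐ x ∂m, |u x| ≤ M := by
    filter_upwards [ae_le_eLpNormEssSup (f := u) (μ := m)] with x hx
    rw [← eLpNorm_exponent_top, hMeq, Real.enorm_eq_ofReal_abs,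
      ENNReal.ofReal_le_ofReal_iff hM0.le] at hx
    exact hx
  set D := p - 1 + p / N with hD
  have hD0 : 0 < D := by linarith
  -- Since M > θ, |u| + θ ≤ 2M almost everywhere, so the growth factor becomes a constant.
  set B := S ^ p * (μ / c) * (2 * M) ^ (q - 1) with hB
  have hB0 : 0 ≤ B := by positivity
  have hlevel : ∀ k, 0 < k → excess m u k ^ p ≤ B * levelMeas m u k ^ D * excess m u k := by
    intro k hk
    have hE := h.levelEnergy_le_of_growth hst hG hk
      ((integrable_max_sub hui k).const_mul (μ * (2 * M) ^ (q - 1))) (by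
        filter_upwards [hae] with x hx
        gcongr
        linarith)
    rw [hH, zero_mul, zero_add, integral_const_mul] at hE
    have hA := levelMeas_nonneg (m := m) (u := u) k
    calc excess m u k ^ p ≤ S ^ p * levelMeas m u k ^ D * levelEnergy m p u Du k :=
          hSob Ω p u Du k hst.finite_measure hp h.mem.1 hk
      _ ≤ S ^ p * levelMeas m u k ^ D * (μ * (2 * M) ^ (q - 1) * excess m u k / c) := by
          gcongr
          rw [le_div_iff₀ hc, mul_comm]
          exact hE
      _ = _ := by rw [hB]; ring
  set β := p / N / D with hβ
  have hβ1 : 1 - (p - 1) / D = β := by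
    rw [hβ, eq_div_iff hD0.ne', sub_mul, div_mul_cancel₀ _ hD0.ne', hD]; ring
  -- Starting at M/2 leaves a gap M/2 that the extinction length must cover. K₁ = 0 switches off the
  -- first alternative.
  have hzero := eq_zero_of_rpow_le_decrease (φ := excess m u) (A := levelMeas m u) (k := M / 2)
      (γ₁ := 0) (γ₂ := (p - 1) / D) (K₁ := 0) (K₂ := B ^ (1 / D)) excess_nonneg levelMeas_nonneg
      (fun a b _ hab => excess_add_le hui hab) le_rfl one_pos (div_nonneg (by linarith) hD0.le)
      (by rw [div_lt_one hD0]; linarith) le_rfl (by positivity)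
      (fun k hk _ hpos => Or.inr (Real.rpow_div_le_of_rpow_le hpos.le (levelMeas_nonneg k) hB0 hD0
        (Real.rpow_sub_one_le_of_rpow_le_mul hpos (hlevel k (by linarith))))) le_rfl
  have hL := ae_abs_le_of_excess_eq_zero hui hzero
  rw [hβ1, zero_mul, zero_div, add_zero] at hL
  set L := M / 2 + B ^ (1 / D) * excess m u (M / 2) ^ β / (2 ^ β - 1) with hLdef
  have hδ := two_rpow_sub_one_pos hN hp
  have hφ := excess_nonneg (m := m) (u := u) (M / 2)
  have hL0 : 0 ≤ L := by positivity
  have hML : M ≤ L := by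
    rw [← ENNReal.ofReal_le_ofReal_iff hL0, ← hMeq, eLpNorm_exponent_top]
    refine eLpNormEssSup_le_of_ae_enorm_bound ?_
    filter_upwards [hL] with x hx
    rw [Real.enorm_eq_ofReal_abs]
    exact ENNReal.ofReal_le_ofReal hx
  set I := ∫ x, |u x| ^ q ∂m with hI
  have hφI : excess m u (M / 2) ≤ (M / 2) ^ (1 - q) * I := by
    have := rpow_mul_excess_le hq huq (by linarith : 0 ≤ M / 2)
    calc excess m u (M / 2)
        = (M / 2) ^ (1 - q) * ((M / 2) ^ (q - 1) * excess m u (M / 2)) := by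
          rw [← mul_assoc, ← Real.rpow_add (by linarith)]; simp
      _ ≤ _ := by gcongr
  have hfin : M / 2 ≤ (S ^ p * (μ / c) * (4 * (M / 2)) ^ (q - 1)) ^ (1 / D) *
      ((M / 2) ^ (1 - q) * I) ^ β / (2 ^ β - 1) := by
    rw [show 4 * (M / 2) = 2 * M by ring, ← hB]
    calc M / 2 ≤ B ^ (1 / D) * excess m u (M / 2) ^ β / (2 ^ β - 1) := by linarith
      _ ≤ _ := by gcongr
  have := le_boundConst_mul hN hS hp (by linarith) (integral_nonneg fun x => by positivity)
    (by positivity) (denominator_pos hN hp hq hqc) hfin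
  linarith

end

theorem theorem1p2 (N : ℕ) (hN : 1 ≤ N) :
    -- every energy critical point is bounded
    (∀ (Ω : Set (RN N)) (p c : ℝ) (H : RN N → ℝ) (f : RN N → ℝ → ℝ)
        (u : RN N → ℝ) (Du : RN N → RN N),
        Standing Ω p c H f →
        (p ≤ (N : ℝ) → ∃ μ θ q : ℝ, 0 ≤ μ ∧ 0 ≤ θ ∧ 1 ≤ q ∧ (q : EReal) ≤ critExp N p ∧
          OneSidedGrowth Ω f μ θ q) →
        IsEnergyCritical Ω p H f u Du →
        MemLp u ⊤ (volume.restrict Ω)) ∧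
    -- the quantitative estimate in the subcritical case
    (∃ C : ℝ → ℝ → ℝ,
        ContinuousOn (fun z : ℝ × ℝ => C z.1 z.2) (subcritical N) ∧
        (∀ z ∈ subcritical N, 0 < C z.1 z.2) ∧
        ∀ (Ω : Set (RN N)) (p c : ℝ) (H : RN N → ℝ) (f : RN N → ℝ → ℝ) (μ θ q : ℝ)
          (u : RN N → ℝ) (Du : RN N → RN N),
          Standing Ω p c H f → H 0 = 0 →
          0 ≤ μ → 0 ≤ θ → 1 ≤ q → (q : EReal) < critExp N p →
          OneSidedGrowth Ω f μ θ q →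
          IsEnergyCritical Ω p H f u Du →
          Integrable (fun x => |u x| ^ q) (volume.restrict Ω) ∧
          eLpNorm u ⊤ (volume.restrict Ω) ≤ ENNReal.ofReal
            (max θ (C p q * ((μ / c) ^ ((N : ℝ) / p) * ∫ x in Ω, |u x| ^ q) ^
              (p / (p * q + (p - q) * (N : ℝ)))))) := by
  obtain ⟨S, hS, hSob⟩ := exists_excess_le N hN
  exact ⟨fun Ω p c H f u Du hst hG h => h.memLp_top hN hst hG,
    boundConst N S, continuousOn_boundConst hN hS, fun z hz => boundConst_pos hN hS hz.1,
    fun Ω p c H f μ θ q u Du hst hH hμ hθ hq hqc hG h =>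
      h.eLpNorm_top_le hN hS hSob hst hH hμ hθ hq hqc hG⟩
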